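/- **Language.** Fix a set of propositional symbols. Ecumenical modal formulas are generated by intuitionistic atoms $p_i$ and classical atoms $p_c$ (one of each for every symbol $p$), $\bot$, $\neg A$, $A\wedge B$, $A\vee_i B$, $A\to_i B$, $A\vee_c B$, $A\to_c B$, $\Box A$, $\Diamond_i A$, $\Diamond_c A$. A formula is *negative* if it is of the form $p_c$, $\neg A$, $A\vee_c B$, $A\to_c B$ or $\Diamond_c A$, and *positive* otherwise; $N$ ranges over negative and $P$ over positive formulas. **Sequents.** Nested sequents are finite trees of multisets of marked formulas: left inputs $A^\bullet$, right (classical) inputs $A^\triangledown$, outputs $A^\circ$. They are written with commas (modulo associativity and commutativity, with unit $\emptyset$) and brackets $[\cdot]$ for child nodes. An *input* sequent $\Lambda$ contains no output, a *full* sequent $\Gamma$ contains exactly one, and $\Delta$ stands for either. A context, written $\Gamma\{\ \}$, $\Lambda\{\ \}$ or $\Delta\{\ \}$, is a sequent with one hole, of the form $\Delta_1,[\Delta_2,[\ldots,[\Delta_n,\{\ \}]\ldots]]$; it is full or input according to the number of outputs outside its hole. $(\cdot)^\bot$ replaces the output, in place, by $\bot^\circ$ and $(\cdot)^*$ erases the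 output. The merge of two contexts with the same number $n$ of levels is $\Delta_1,\Delta_1',[\Delta_2,\Delta_2',[\ldots,[\Delta_n,\Delta_n',\{\ \}]\ldots]]$. **The system nEK** has the following rules (premises $/$ conclusion), where every conclusion is a full sequent. * $\wedge^\bullet$: $\Gamma\{A^\bullet,B^\bullet\}\,/\,\Gamma\{(A\wedge B)^\bullet\}$; $\quad\wedge^\circ$: $\Lambda\{A^\circ\},\ \Lambda\{B^\circ\}\,/\,\Lambda\{(A\wedge B)^\circ\}$; $\quad\bot^\bullet$: $\,/\,\Gamma\{\bot^\bullet\}$; * $\vee_i^\bullet$: $\Gamma\{A^\bullet\},\ \Gamma\{B^\bullet\}\,/\,\Gamma\{(A\vee_i B)^\bullet\}$; $\quad\vee_{i_j}^\circ$: $\Lambda\{A_j^\circ\}\,/\,\Lambda\{(A_1\vee_i A_2)^\circ\}$, $j=1,2$; * $\to_i^\bullet$: $\Gamma^*\{(A\to_iB)^\bullet,A^\circ\},\ \Gamma\{B^\bullet\}\,/\,\Gamma\{(A\to_i B)^\bullet\}$; $\quad\to_i^\circ$: $\Lambda\{A^\bullet,B^\circ\}\,/\,\Lambda\{(A\to_i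 B)^\circ\}$; * $\neg^\bullet$: $\Gamma^*\{(\neg A)^\bullet,A^\circ\}\,/\,\Gamma^\bot\{(\neg A)^\bullet\}$; $\quad\neg^\triangledown$: $\Gamma^\bot\{A^\bullet\}\,/\,\Gamma^\bot\{(\neg A)^\triangledown\}$; * $\to_c^\bullet$: $\Gamma^*\{(A\to_cB)^\bullet,A^\circ\},\ \Gamma^\bot\{B^\bullet\}\,/\,\Gamma^\bot\{(A\to_c B)^\bullet\}$; $\quad\to_c^\triangledown$: $\Gamma^\bot\{A^\bullet,B^\triangledown\}\,/\,\Gamma^\bot\{(A\to_c B)^\triangledown\}$; * $\vee_c^\bullet$: $\Gamma^\bot\{A^\bullet\},\ \Gamma^\bot\{B^\bullet\}\,/\,\Gamma^\bot\{(A\vee_c B)^\bullet\}$; $\quad\vee_c^\triangledown$: $\Gamma^\bot\{A^\triangledown,B^\triangledown\}\,/\,\Gamma^\bot\{(A\vee_c B)^\triangledown\}$; * $p_c^\bullet$: $\Gamma^\bot\{p_i^\bullet\}\,/\,\Gamma^\bot\{p_c^\bullet\}$; $\quad p_c^\triangledown$: $\Gamma^\bot\{p_i^\triangledown\}\,/\,\Gamma^\bot\{p_c^\triangledown\}$;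 * $\Box^\bullet$: $\Delta_1\{(\Box A)^\bullet,[A^\bullet,\Delta_2]\}\,/\,\Delta_1\{(\Box A)^\bullet,[\Delta_2]\}$; $\quad\Box^\circ$: $\Lambda\{[A^\circ]\}\,/\,\Lambda\{(\Box A)^\circ\}$; * $\Diamond_i^\bullet$: $\Gamma\{[A^\bullet]\}\,/\,\Gamma\{(\Diamond_i A)^\bullet\}$; $\quad\Diamond_i^\circ$: $\Lambda_1\{[A^\circ,\Lambda_2]\}\,/\,\Lambda_1\{(\Diamond_i A)^\circ,[\Lambda_2]\}$; * $\Diamond_c^\bullet$: $\Gamma^\bot\{[A^\bullet]\}\,/\,\Gamma^\bot\{(\Diamond_c A)^\bullet\}$; $\quad\Diamond_c^\triangledown$: $\Delta_1^\bot\{(\Diamond_c A)^\triangledown,[A^\triangledown,\Delta_2^\bot]\}\,/\,\Delta_1^\bot\{(\Diamond_c A)^\triangledown,[\Delta_2^\bot]\}$; * $\mathsf{init}_i$: $\,/\,\Lambda\{A^\bullet,A^\circ\}$; $\quad\mathsf{init}_c$: $\,/\,\Gamma^\bot\{A^\bullet,A^\triangledown\}$; * $\mathsf D$: $\Gamma^*\{P^\triangledown,P^\circ\}\,/\,\Gamma^\bot\{P^\triangledown\}$;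 $\quad\mathsf{store}$: $\Lambda\{N^\triangledown,\bot^\circ\}\,/\,\Lambda\{N^\circ\}$; $\quad\mathsf W$: $\Gamma^\bot\,/\,\Gamma$. The cut rules are $\mathsf{icut}$: $\Gamma^*\{P^\circ\},\ \Gamma\{P^\bullet\}\,/\,\Gamma\{\emptyset\}$ and $\mathsf{ccut}$: $\Gamma^{P}\{N^\triangledown\},\ \Gamma\{N^\bullet\}\,/\,\Gamma\{\emptyset\}$, where $\Gamma^P\{N^\triangledown\}$ is either $\Gamma^\bot\{N^\triangledown\}$ or the result of adding to $\Gamma^*\{N^\triangledown\}$ an output $P^\circ$ next to an occurrence, anywhere in $\Gamma$, of a right input $P^\triangledown$ with $P$ positive. *Provable* means derivable without the cut rules. A rule is *invertible* if in each of its instances the premises are provable whenever the conclusion is. It is *totally invertible* if moreover it can be applied in every context in which the part displayed in the hole of its conclusion occurs (whatever the output is). A rule is *admissible* if in each of its instances the conclusion is provable whenever the premises are. **Theorem.** In nEK: 1. The rules $\vee_c^\bullet,\vee_c^\triangledown,\to_c^\bullet,\to_c^\triangledown,\neg^\bullet,\neg^\triangledown,p_c^\bullet,p_c^\triangledown,\Diamond_c^\bullet,\Diamond_c^\triangledown$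 and $\mathsf D$ are invertible. 2. The rules $\wedge^\bullet,\wedge^\circ,\vee_i^\bullet,\to_i^\circ,\Diamond_i^\bullet,\Box^\bullet,\Box^\circ$ and $\mathsf{store}$ are totally invertible. 3. Classical weakening $\Gamma\,/\,\Lambda\otimes\Gamma$ and classical contraction $\Lambda\otimes\Lambda\otimes\Gamma\,/\,\Lambda\otimes\Gamma$ are admissible. Here the merge is taken along an arbitrary path: for an input context $\Lambda\{\ \}$, a context $\Gamma\{\ \}$ with the same number of levels and a sequent $S$ with $\Gamma\{S\}$ full, if $\Gamma\{S\}$ is provable then so is $(\Lambda\otimes\Gamma)\{S\}$, and if $(\Lambda\otimes\Lambda\otimes\Gamma)\{S\}$ is provable then so is $(\Lambda\otimes\Gamma)\{S\}$. 4. The rules $\mathsf{icut}$ and $\mathsf{ccut}$ are admissible; hence a sequent is derivable with the cut rules if and only if it is provable without them. The ecumenical weight $\mathrm{ew}$ is defined by $\mathrm{ew}(p_i)=\mathrm{ew}(\bot)=0$, $\mathrm{ew}(p_c)=4$, $\mathrm{ew}(\neg A)=\mathrm{ew}(A)+1$, $\mathrm{ew}(A\star B)=\mathrm{ew}(A)+\mathrm{ew}(B)+1$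 for $\star\in\{\wedge,\vee_i,\to_i\}$, $\mathrm{ew}(A\circ B)=\mathrm{ew}(A)+\mathrm{ew}(B)+4$ for $\circ\in\{\vee_c,\to_c\}$, and it is extended to the modalities by $\mathrm{ew}(\Diamond_iA)=\mathrm{ew}(A)+1$, $\mathrm{ew}(\Box A)=\mathrm{ew}(A)+1$, $\mathrm{ew}(\Diamond_cA)=\mathrm{ew}(A)+4$. -/

import Mathlib

namespace NestedEK

/-- Ecumenical modal formulas over a set `α` of propositional symbols.  Every symbol `p` gives an
intuitionistic atom `p_i` and a classical atom `p_c`. -/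
inductive Formula (α : Type*) where
  | atomI (p : α)
  | atomC (p : α)
  | bot
  | neg (A : Formula α)
  | and (A B : Formula α)
  | orI (A B : Formula α)
  | impI (A B : Formula α)
  | orC (A B : Formula α)
  | impC (A B : Formula α)
  | box (A : Formula α)
  | diaI (A : Formula α)
  | diaC (A : Formula α)

namespace Formula

variable {α : Type*}

/-- Negative formulas: the main connective is classical (this includes the classical atoms) or is
the negation. -/
def Negative : Formula α → Prop
  | atomC _ => True
  | neg _ => True
  | orC _ _ => True
  | impC _ _ => True
  | diaC _ => True
  | _ => False

/-- Positive formulas: all the others. -/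
def Positive (A : Formula α) : Prop := ¬ A.Negative

/-- The ecumenical weight, extended to the modalities. -/
def ew : Formula α → ℕ
  | atomI _ => 0
  | atomC _ => 4
  | bot => 0
  | neg A => A.ew + 1
  | and A B => A.ew + B.ew + 1
  | orI A B => A.ew + B.ew + 1
  | impI A B => A.ew + B.ew + 1
  | orC A B => A.ew + B.ew + 4
  | impC A B => A.ew + B.ew + 4
  | box A => A.ew + 1
  | diaI A => A.ew + 1
  | diaC A => A.ew + 4

end Formula

/-- Expressions for nested sequents: left inputs, right (classical) inputs, outputs, the comma and
the bracket.  The comma is read modulo `NSeq.Equiv` below. -/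
inductive NSeq (α : Type*) where
  | empty
  | left (A : Formula α)
  | right (A : Formula α)
  | out (A : Formula α)
  | comma (S T : NSeq α)
  | brack (S : NSeq α)

namespace NSeq

variable {α : Type*}

/-- Equality of nested sequents modulo associativity and commutativity of the comma (with the empty
sequent as its unit), at every depth. -/
inductive Equiv : NSeq α → NSeq α → Prop
  | refl (S) : Equiv S S
  | symm {S T} : Equiv S T → Equiv T S
  | trans {S T U} : Equiv S T → Equiv T U → Equiv S U
  | comma {S S' T T'} : Equiv S S' → Equiv T T' → Equiv (NSeq.comma S T) (NSeq.comma S' T')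
  | brack {S S'} : Equiv S S' → Equiv (NSeq.brack S) (NSeq.brack S')
  | assoc (S T U) :
      Equiv (NSeq.comma (NSeq.comma S T) U) (NSeq.comma S (NSeq.comma T U))
  | comm (S T) : Equiv (NSeq.comma S T) (NSeq.comma T S)
  | unit (S) : Equiv (NSeq.comma NSeq.empty S) S

/-- The number of output formulas, at all depths. -/
def outs : NSeq α → ℕ
  | empty => 0
  | left _ => 0
  | right _ => 0
  | out _ => 1
  | comma S T => S.outs + T.outs
  | brack S => S.outs

/-- Input sequents have no output formula. -/
def IsInput (S : NSeq α) : Prop := S.outs = 0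

/-- Full sequents have exactly one output formula. -/
def IsFull (S : NSeq α) : Prop := S.outs = 1

/-- Replace the output formula (if any), in place, by `⊥`. -/
def botOut : NSeq α → NSeq α
  | empty => empty
  | left A => left A
  | right A => right A
  | out _ => out Formula.bot
  | comma S T => comma S.botOut T.botOut
  | brack S => brack S.botOut

/-- Erase the output formula (if any). -/
def erase : NSeq α → NSeq α
  | empty => empty
  | left A => left A
  | right A => right A
  | out _ => empty
  | comma S T => comma S.erase T.erase
  | brack S => brack S.erase

/-- `AddOut P S S'`: the sequent `S'` is `S` with the output `P` added next to one occurrence, at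
any depth, of the right input `P`. -/
inductive AddOut (P : Formula α) : NSeq α → NSeq α → Prop
  | here : AddOut P (right P) (NSeq.comma (right P) (out P))
  | commaL {S S'} (T) : AddOut P S S' → AddOut P (NSeq.comma S T) (NSeq.comma S' T)
  | commaR {T T'} (S) : AddOut P T T' → AddOut P (NSeq.comma S T) (NSeq.comma S T')
  | brack {S S'} : AddOut P S S' → AddOut P (NSeq.brack S) (NSeq.brack S')

end NSeq

open NSeq

/-- Contexts with one hole: `Δ₁, [Δ₂, [ … , [Δₙ, { }] … ]]` with `n ≥ 1`. -/
inductive Ctx (α : Type*) where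
  | hole (Δ : NSeq α)
  | nest (Δ : NSeq α) (C : Ctx α)

namespace Ctx

variable {α : Type*}

/-- Replace the hole by a sequent. -/
def fill : Ctx α → NSeq α → NSeq α
  | hole Δ, S => comma Δ S
  | nest Δ C, S => comma Δ (brack (C.fill S))

def outs : Ctx α → ℕ
  | hole Δ => Δ.outs
  | nest Δ C => Δ.outs + C.outs

/-- Input contexts `Λ{ }`. -/
def IsInput (C : Ctx α) : Prop := C.outs = 0

/-- Full contexts `Γ{ }`: the output formula is outside the hole. -/
def IsFull (C : Ctx α) : Prop := C.outs = 1

def botOut : Ctx α → Ctx α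
  | hole Δ => hole Δ.botOut
  | nest Δ C => nest Δ.botOut C.botOut

def erase : Ctx α → Ctx α
  | hole Δ => hole Δ.erase
  | nest Δ C => nest Δ.erase C.erase

/-- `IsMerge C D M`: the contexts `C` and `D` have the same number of levels, and `M` is their merge
`C ⊗ D`, obtained by zipping them along the path from the root to the hole. -/
inductive IsMerge : Ctx α → Ctx α → Ctx α → Prop
  | hole (Δ Θ) : IsMerge (hole Δ) (hole Θ) (hole (comma Δ Θ))
  | nest (Δ Θ) {C D M} : IsMerge C D M →
      IsMerge (nest Δ C) (nest Θ D) (nest (comma Δ Θ) M)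

end Ctx

/-- The names of the rules.  A suffix `L` marks left input rules, `R` output rules and `T`
right input (classical) rules. -/
inductive Rule where
  | andL | andR | orIL | orIR₁ | orIR₂ | botL | impIL | impIR | negL | negT
  | impCL | impCT | orCL | orCT | atomCL | atomCT
  | boxL | boxR | diaIL | diaIR | diaCL | diaCT
  | ginit | gcinit | der | store | weak
  | icut | ccut

variable {α : Type*}

/-- `Inst r ps S`: there is an instance of the rule `r` with list of premises `ps` and
conclusion `S`. -/
inductive Inst : Rule → List (NSeq α) → NSeq α → Prop
  | andL (C : Ctx α) (A B : Formula α) : C.IsFull →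
      Inst .andL [C.fill (comma (left A) (left B))] (C.fill (left (.and A B)))
  | andR (C : Ctx α) (A B : Formula α) : C.IsInput →
      Inst .andR [C.fill (out A), C.fill (out B)] (C.fill (out (.and A B)))
  | orIL (C : Ctx α) (A B : Formula α) : C.IsFull →
      Inst .orIL [C.fill (left A), C.fill (left B)] (C.fill (left (.orI A B)))
  | orIR₁ (C : Ctx α) (A B : Formula α) : C.IsInput →
      Inst .orIR₁ [C.fill (out A)] (C.fill (out (.orI A B)))
  | orIR₂ (C : Ctx α) (A B : Formula α) : C.IsInput →
      Inst .orIR₂ [C.fill (out B)] (C.fill (out (.orI A B)))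
  | botL (C : Ctx α) : C.IsFull →
      Inst .botL [] (C.fill (left .bot))
  | impIL (C : Ctx α) (A B : Formula α) : C.IsFull →
      Inst .impIL [C.erase.fill (comma (left (.impI A B)) (out A)), C.fill (left B)]
        (C.fill (left (.impI A B)))
  | impIR (C : Ctx α) (A B : Formula α) : C.IsInput →
      Inst .impIR [C.fill (comma (left A) (out B))] (C.fill (out (.impI A B)))
  | negL (C : Ctx α) (A : Formula α) : C.IsFull →
      Inst .negL [C.erase.fill (comma (left (.neg A)) (out A))] (C.botOut.fill (left (.neg A)))
  | negT (C : Ctx α) (A : Formula α) : C.IsFull →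
      Inst .negT [C.botOut.fill (left A)] (C.botOut.fill (right (.neg A)))
  | impCL (C : Ctx α) (A B : Formula α) : C.IsFull →
      Inst .impCL [C.erase.fill (comma (left (.impC A B)) (out A)), C.botOut.fill (left B)]
        (C.botOut.fill (left (.impC A B)))
  | impCT (C : Ctx α) (A B : Formula α) : C.IsFull →
      Inst .impCT [C.botOut.fill (comma (left A) (right B))] (C.botOut.fill (right (.impC A B)))
  | orCL (C : Ctx α) (A B : Formula α) : C.IsFull →
      Inst .orCL [C.botOut.fill (left A), C.botOut.fill (left B)] (C.botOut.fill (left (.orC A B)))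
  | orCT (C : Ctx α) (A B : Formula α) : C.IsFull →
      Inst .orCT [C.botOut.fill (comma (right A) (right B))] (C.botOut.fill (right (.orC A B)))
  | atomCL (C : Ctx α) (p : α) : C.IsFull →
      Inst .atomCL [C.botOut.fill (left (.atomI p))] (C.botOut.fill (left (.atomC p)))
  | atomCT (C : Ctx α) (p : α) : C.IsFull →
      Inst .atomCT [C.botOut.fill (right (.atomI p))] (C.botOut.fill (right (.atomC p)))
  | boxL (C : Ctx α) (A : Formula α) (Δ : NSeq α) : C.outs + Δ.outs = 1 →
      Inst .boxL [C.fill (comma (left (.box A)) (brack (comma (left A) Δ)))]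
        (C.fill (comma (left (.box A)) (brack Δ)))
  | boxR (C : Ctx α) (A : Formula α) : C.IsInput →
      Inst .boxR [C.fill (brack (out A))] (C.fill (out (.box A)))
  | diaIL (C : Ctx α) (A : Formula α) : C.IsFull →
      Inst .diaIL [C.fill (brack (left A))] (C.fill (left (.diaI A)))
  | diaIR (C : Ctx α) (A : Formula α) (Δ : NSeq α) : C.IsInput → Δ.IsInput →
      Inst .diaIR [C.fill (brack (comma (out A) Δ))] (C.fill (comma (out (.diaI A)) (brack Δ)))
  | diaCL (C : Ctx α) (A : Formula α) : C.IsFull →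
      Inst .diaCL [C.botOut.fill (brack (left A))] (C.botOut.fill (left (.diaC A)))
  | diaCT (C : Ctx α) (A : Formula α) (Δ : NSeq α) : C.outs + Δ.outs = 1 →
      Inst .diaCT [C.botOut.fill (comma (right (.diaC A)) (brack (comma (right A) Δ.botOut)))]
        (C.botOut.fill (comma (right (.diaC A)) (brack Δ.botOut)))
  | ginit (C : Ctx α) (A : Formula α) : C.IsInput →
      Inst .ginit [] (C.fill (comma (left A) (out A)))
  | gcinit (C : Ctx α) (A : Formula α) : C.IsFull →
      Inst .gcinit [] (C.botOut.fill (comma (left A) (right A)))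
  | der (C : Ctx α) (P : Formula α) : C.IsFull → P.Positive →
      Inst .der [C.erase.fill (comma (right P) (out P))] (C.botOut.fill (right P))
  | store (C : Ctx α) (N : Formula α) : C.IsInput → N.Negative →
      Inst .store [C.fill (comma (right N) (out .bot))] (C.fill (out N))
  | weak (S : NSeq α) : S.IsFull →
      Inst .weak [S.botOut] S
  | icut (C : Ctx α) (P : Formula α) : C.IsFull → P.Positive →
      Inst .icut [C.erase.fill (out P), C.fill (left P)] (C.fill empty)
  | ccut (C : Ctx α) (N : Formula α) : C.IsFull → N.Negative →
      Inst .ccut [C.botOut.fill (right N), C.fill (left N)] (C.fill empty)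
  | ccutP (C : Ctx α) (N P : Formula α) (S : NSeq α) : C.IsFull → N.Negative → P.Positive →
      AddOut P (C.erase.fill (right N)) S →
      Inst .ccut [S, C.fill (left N)] (C.fill empty)

/-- Sequents with a derivation all of whose rule names satisfy `R`; sequents are taken
modulo `NSeq.Equiv`. -/
inductive Derivable (R : Rule → Prop) : NSeq α → Prop
  | step {r ps S S'} : R r → Inst r ps S → NSeq.Equiv S S' → (∀ T ∈ ps, Derivable R T) →
      Derivable R S'

/-- Provability in the nested system without the cut rules. -/
def Provable (S : NSeq α) : Prop := Derivable (fun r => r ≠ .icut ∧ r ≠ .ccut) S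

/-- Provability in the nested system with the cut rules. -/
def ProvableWithCut (S : NSeq α) : Prop := Derivable (fun _ => True) S

/-- A rule is invertible if, in each of its instances, the premises are provable whenever the
conclusion is. -/
def Invertible (α : Type*) (r : Rule) : Prop :=
  ∀ (ps : List (NSeq α)) (S : NSeq α), Inst r ps S → Provable S → ∀ T ∈ ps, Provable T

/-- The part of the conclusion that a rule of the second item displays in the hole. -/
inductive Displayed : Rule → NSeq α → Prop
  | andL (A B : Formula α) : Displayed .andL (left (.and A B))
  | andR (A B : Formula α) : Displayed .andR (out (.and A B))
  | orIL (A B : Formula α) : Displayed .orIL (left (.orI A B))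
  | impIR (A B : Formula α) : Displayed .impIR (out (.impI A B))
  | diaIL (A : Formula α) : Displayed .diaIL (left (.diaI A))
  | boxL (A : Formula α) (Δ : NSeq α) : Displayed .boxL (comma (left (.box A)) (brack Δ))
  | boxR (A : Formula α) : Displayed .boxR (out (.box A))
  | store (N : Formula α) : N.Negative → Displayed .store (out N)

/-- A rule is totally invertible if it is invertible and can be applied in every context in which
its displayed part occurs, whatever the output formula is. -/
def TotallyInvertible (α : Type*) (r : Rule) : Prop :=
  Invertible α r ∧
    ∀ (C : Ctx α) (X : NSeq α), Displayed r X → (C.fill X).IsFull → ∃ ps, Inst r ps (C.fill X)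

/-- A rule, given by its set of instances, is admissible if it preserves provability. -/
def Admissible (I : List (NSeq α) → NSeq α → Prop) : Prop :=
  ∀ ps S, I ps S → (∀ T ∈ ps, Provable T) → Provable S

/-- Instances of classical weakening: from `Γ` infer `Λ ⊗ Γ`, where the merge is taken along an
arbitrary path, with the material `S` at the end of the path. -/
inductive WeakC : List (NSeq α) → NSeq α → Prop
  | mk (L G M : Ctx α) (S : NSeq α) : L.IsInput → (G.fill S).IsFull → Ctx.IsMerge L G M →
      WeakC [G.fill S] (M.fill S)

/-- Instances of classical contraction: from `Λ ⊗ Λ ⊗ Γ` infer `Λ ⊗ Γ`. -/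
inductive ContrC : List (NSeq α) → NSeq α → Prop
  | mk (L G M M' : Ctx α) (S : NSeq α) : L.IsInput → (G.fill S).IsFull → Ctx.IsMerge L G M →
      Ctx.IsMerge L M M' → ContrC [M'.fill S] (M.fill S)

end NestedEK

/-! The whole theorem follows from one semantic cut elimination, in a model built out of cut-free
provability. A world is a finite tree of multisets of inputs. A larger world has more nodes and
keeps each input, or the results of decomposing it (`Has`), since many rules consume their principal
formula. Forcing is of Beth–Kripke type. An intuitionistic atom is forced at a node when its output
is provable there in every extension, and `⊥` when every extension proves `⊥` at every node. The
clauses for `∨ᵢ` and `◇ᵢ` use covers (`Cov`): provability at a world may be checked on the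
extensions satisfying a property. Negative formulas are forced by clauses of the form `Neg V` with
`V` persistent, hence are stable under double negation. Forcing is persistent and local for covers
(`forced_mono`, `forced_glue`).

The link with the calculus is `adequate`, an induction on formulas: a forced formula has a provable
output, a left input is forced, a right input is refuted. Each logical rule is used here, and no
cut.

A sequent is valid if, whenever its tree maps to a world that satisfies its inputs, its output is
forced; this is phrased with an arbitrary goal `D` that the output must entail. Every rule, cuts
included, preserves validity (`sound_inst`). Conversely, a full sequent without its output is itself
a world; it satisfies its own inputs, so validity forces the output there and adequacy yields a
cut-free proof (`complete`).

For full sequents, validity, provability and provability with cut therefore coincide. Admissibility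
becomes preservation of validity, and invertibility the passage of validity from conclusion to
premises (`valid_premises`). Weakening and contraction only use that maps of trees to worlds may
forget parts of a merge and need not be injective. -/

namespace NestedEK

/-! ### Nested sequents modulo the equations of the comma -/

/-- The setoid of nested sequents. -/
instance seqSetoid (α : Type*) : Setoid (NSeq α) where
  r := NSeq.Equiv
  iseqv := ⟨.refl, .symm, .trans⟩

/-- Nested sequents modulo the equations of the comma. -/
def QSeq (α : Type*) := Quotient (seqSetoid α)

namespace QSeq

variable {α : Type*}

/-- The class of a nested sequent. -/
def mk (S : NSeq α) : QSeq α := Quotient.mk _ S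

theorem mk_eq {S T : NSeq α} : mk S = mk T ↔ NSeq.Equiv S T := Quotient.eq (r := seqSetoid α)

theorem exists_rep (q : QSeq α) : ∃ S, mk S = q := Quotient.exists_rep q

instance : Zero (QSeq α) := ⟨mk .empty⟩

instance : Add (QSeq α) := ⟨Quotient.map₂ NSeq.comma fun _ _ h _ _ h' => .comma h h'⟩

instance : AddCommMonoid (QSeq α) where
  add_assoc := by
    rintro ⟨S⟩ ⟨T⟩ ⟨U⟩; exact mk_eq.2 (.assoc S T U)
  add_comm := by
    rintro ⟨S⟩ ⟨T⟩; exact mk_eq.2 (.comm S T)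
  zero_add := by
    rintro ⟨S⟩; exact mk_eq.2 (.unit S)
  add_zero := by
    rintro ⟨S⟩; exact mk_eq.2 (.trans (.comm _ _) (.unit S))
  nsmul := nsmulRec

theorem mk_empty : mk (.empty : NSeq α) = 0 := rfl

theorem mk_comma (S T : NSeq α) : mk (.comma S T) = mk S + mk T := rfl

/-- The bracket. -/
def brack : QSeq α → QSeq α := Quotient.map NSeq.brack fun _ _ h => .brack h

theorem mk_brack (S : NSeq α) : mk (.brack S) = brack (mk S) := rfl

/-- A left input. -/
def left (A : Formula α) : QSeq α := mk (.left A)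

/-- A right input. -/
def right (A : Formula α) : QSeq α := mk (.right A)

/-- An output. -/
def out (A : Formula α) : QSeq α := mk (.out A)

theorem equiv_outs {S T : NSeq α} (h : NSeq.Equiv S T) : S.outs = T.outs := by
  induction h <;> simp_all [NSeq.outs] <;> omega

theorem equiv_erase {S T : NSeq α} (h : NSeq.Equiv S T) : NSeq.Equiv S.erase T.erase := by
  induction h with
  | refl => exact .refl _
  | symm _ h => exact .symm h
  | trans _ _ h h' => exact .trans h h'
  | comma _ _ h h' => exact .comma h h'
  | brack _ h => exact .brack h
  | assoc => exact .assoc _ _ _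
  | comm => exact .comm _ _
  | unit => exact .unit _

theorem equiv_botOut {S T : NSeq α} (h : NSeq.Equiv S T) : NSeq.Equiv S.botOut T.botOut := by
  induction h with
  | refl => exact .refl _
  | symm _ h => exact .symm h
  | trans _ _ h h' => exact .trans h h'
  | comma _ _ h h' => exact .comma h h'
  | brack _ h => exact .brack h
  | assoc => exact .assoc _ _ _
  | comm => exact .comm _ _
  | unit => exact .unit _

/-- The number of outputs. -/
def outs : QSeq α →+ ℕ where
  toFun := Quotient.lift NSeq.outs fun _ _ => equiv_outs
  map_zero' := rfl
  map_add' := by rintro ⟨S⟩ ⟨T⟩; rfl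

/-- Erasing the outputs. -/
def erase : QSeq α →+ QSeq α where
  toFun := Quotient.map NSeq.erase fun _ _ => equiv_erase
  map_zero' := rfl
  map_add' := by rintro ⟨S⟩ ⟨T⟩; rfl

/-- Replacing the outputs by `⊥`. -/
def botOut : QSeq α →+ QSeq α where
  toFun := Quotient.map NSeq.botOut fun _ _ => equiv_botOut
  map_zero' := rfl
  map_add' := by rintro ⟨S⟩ ⟨T⟩; rfl

theorem outs_mk (S : NSeq α) : outs (mk S) = S.outs := rfl
theorem erase_mk (S : NSeq α) : erase (mk S) = mk S.erase := rfl
theorem botOut_mk (S : NSeq α) : botOut (mk S) = mk S.botOut := rfl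

@[simp] theorem outs_left (A : Formula α) : outs (left A) = 0 := rfl
@[simp] theorem outs_right (A : Formula α) : outs (right A) = 0 := rfl
@[simp] theorem outs_out (A : Formula α) : outs (out A) = 1 := rfl
@[simp] theorem outs_brack (q : QSeq α) : outs (brack q) = outs q := by
  obtain ⟨S, rfl⟩ := exists_rep q; rfl
@[simp] theorem erase_left (A : Formula α) : erase (left A) = left A := rfl
@[simp] theorem erase_right (A : Formula α) : erase (right A) = right A := rfl
@[simp] theorem erase_out (A : Formula α) : erase (out A) = 0 := rfl
@[simp] theorem erase_brack (q : QSeq α) : erase (brack q) = brack (erase q) := by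
  obtain ⟨S, rfl⟩ := exists_rep q; rfl
@[simp] theorem botOut_left (A : Formula α) : botOut (left A) = left A := rfl
@[simp] theorem botOut_right (A : Formula α) : botOut (right A) = right A := rfl
@[simp] theorem botOut_out (A : Formula α) : botOut (out A) = out .bot := rfl
@[simp] theorem botOut_brack (q : QSeq α) : botOut (brack q) = brack (botOut q) := by
  obtain ⟨S, rfl⟩ := exists_rep q; rfl

/-- The last step of a derivation is already closed under `NSeq.Equiv`, so no induction is needed.
This is what lets provability descend to the quotient. -/
theorem derivable_of_equiv {R : Rule → Prop} {S T : NSeq α} (h : NSeq.Equiv S T)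
    (hS : Derivable R S) : Derivable R T := by
  obtain ⟨hr, hi, he, hp⟩ := hS
  exact .step hr hi (he.trans h) hp

/-- Provability of a class of nested sequents. -/
def Prv : QSeq α → Prop :=
  Quotient.lift Provable fun _ _ h =>
    propext ⟨derivable_of_equiv h, derivable_of_equiv h.symm⟩

theorem prv_mk (S : NSeq α) : Prv (mk S) ↔ Provable S := Iff.rfl

theorem prv_of_inst {r : Rule} {ps : List (NSeq α)} {S : NSeq α} (h : Inst r ps S)
    (hr : r ≠ .icut ∧ r ≠ .ccut) (hp : ∀ T ∈ ps, Prv (mk T)) : Prv (mk S) :=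
  Derivable.step hr h (.refl _) hp

end QSeq

/-! ### Contexts acting on classes of sequents. -/

namespace Ctx

variable {α : Type*}

/-- Filling the hole with a class of sequents. -/
def qfill : Ctx α → QSeq α → QSeq α
  | hole Δ, q => QSeq.mk Δ + q
  | nest Δ C, q => QSeq.mk Δ + QSeq.brack (C.qfill q)

theorem mk_fill (C : Ctx α) (S : NSeq α) : QSeq.mk (C.fill S) = C.qfill (QSeq.mk S) := by
  induction C with
  | hole Δ => rfl
  | nest Δ C ih => rw [fill, qfill, ← ih]; rfl

theorem outs_qfill (C : Ctx α) (q : QSeq α) : QSeq.outs (C.qfill q) = C.outs + QSeq.outs q := by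
  induction C with
  | hole Δ => simp [qfill, Ctx.outs, QSeq.outs_mk]
  | nest Δ C ih => simp [qfill, Ctx.outs, QSeq.outs_mk, ih, add_assoc]

/-- Move the hole into a new bracket with content `E`. -/
def push : Ctx α → NSeq α → Ctx α
  | hole Δ, E => nest Δ (hole E)
  | nest Δ C, E => nest Δ (C.push E)

theorem qfill_push (C : Ctx α) (E : NSeq α) (q : QSeq α) :
    (C.push E).qfill q = C.qfill (QSeq.brack (QSeq.mk E + q)) := by
  induction C with
  | hole Δ => rfl
  | nest Δ C ih => simp [push, qfill, ih]

theorem erase_push (C : Ctx α) (E : NSeq α) : (C.push E).erase = C.erase.push E.erase := by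
  induction C with
  | hole Δ => rfl
  | nest Δ C ih => simp [push, erase, ih]

theorem botOut_push (C : Ctx α) (E : NSeq α) : (C.push E).botOut = C.botOut.push E.botOut := by
  induction C with
  | hole Δ => rfl
  | nest Δ C ih => simp [push, botOut, ih]

end Ctx

/-! ### Labelled trees -/

section Collapse

variable {α : Type*}

open QSeq

/-- The sequent of the tree with nodes `0, …, n`, parent function `par` and contents `c`. -/
def collapse (par : ℕ → ℕ) : ℕ → (ℕ → QSeq α) → QSeq α
  | 0, c => c 0
  -- As parents have smaller indices, the last node is a leaf of the remaining tree and can be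
  -- folded, as a bracket, into the content of its parent.
  | n + 1, c => collapse par n (c + Pi.single (par (n + 1)) (brack (c (n + 1))))

/-- `par` sends each node `1, …, n` to a smaller node. -/
def IsParent (par : ℕ → ℕ) (n : ℕ) : Prop := ∀ k, 1 ≤ k → k ≤ n → par k < k

theorem IsParent.mono {par : ℕ → ℕ} {n m : ℕ} (h : IsParent par n) (hm : m ≤ n) :
    IsParent par m := fun k h1 h2 => h k h1 (h2.trans hm)

theorem collapse_congr {par par' : ℕ → ℕ} {n : ℕ} (hp : ∀ k, 1 ≤ k → k ≤ n → par k = par' k) :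
    ∀ {c c' : ℕ → QSeq α}, (∀ k ≤ n, c k = c' k) → collapse par n c = collapse par' n c' := by
  induction n with
  | zero => intro c c' h; exact h 0 le_rfl
  | succ n ih =>
    intro c c' h
    refine ih (fun k h1 h2 => hp k h1 (by omega)) fun k hk => ?_
    simp [h k (by omega), h (n + 1) le_rfl, hp (n + 1) (by omega) le_rfl]

theorem comp_add_single (f : QSeq α →+ QSeq α) (c : ℕ → QSeq α) (i : ℕ) (q : QSeq α) :
    f ∘ (c + Pi.single i q) = f ∘ c + Pi.single i (f q) := by
  funext j
  by_cases hj : j = i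
  · subst hj; simp
  · simp [hj]

theorem map_collapse (f : QSeq α →+ QSeq α) (hf : ∀ q, f (brack q) = brack (f q)) (par : ℕ → ℕ)
    (n : ℕ) (c : ℕ → QSeq α) : f (collapse par n c) = collapse par n (f ∘ c) := by
  induction n generalizing c with
  | zero => rfl
  | succ n ih => rw [collapse, ih, comp_add_single, hf]; rfl

/-- `IsParent` is essential: it ensures that each bracket lands in a node that is still counted, so
that folding loses no output. -/
theorem outs_collapse {par : ℕ → ℕ} {n : ℕ} (hp : IsParent par n) (c : ℕ → QSeq α) :
    outs (collapse par n c) = ∑ i ∈ Finset.range (n + 1), outs (c i) := by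
  induction n generalizing c with
  | zero => simp [collapse]
  | succ n ih =>
    rw [collapse, ih (hp.mono (by omega)), Finset.sum_range_succ _ (n + 1)]
    have h1 : par (n + 1) ∈ Finset.range (n + 1) := by
      have := hp (n + 1) (by omega) le_rfl; simpa using this
    have h2 : ∀ i, outs ((Pi.single (par (n + 1)) (brack (c (n + 1))) : ℕ → QSeq α) i) =
        if i = par (n + 1) then outs (c (n + 1)) else 0 := by
      intro i; by_cases h : i = par (n + 1)
      · subst h; simp
      · simp [h]
    simp [Finset.sum_add_distrib, h2]
    exact fun h => absurd (Finset.mem_range.1 h1) (by omega)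

/-- A node of a tree is the hole of a context. -/
theorem exists_ctx {par : ℕ → ℕ} {n : ℕ} (hp : IsParent par n) (c : ℕ → QSeq α) {x : ℕ}
    (hx : x ≤ n) : ∃ C : Ctx α, ∀ q,
      collapse par n (c + Pi.single x q) = C.qfill q ∧
      collapse par n (erase ∘ c + Pi.single x q) = C.erase.qfill q ∧
      collapse par n (botOut ∘ c + Pi.single x q) = C.botOut.qfill q := by
  induction n generalizing c x with
  | zero =>
    obtain rfl : x = 0 := by omega
    obtain ⟨S, hS⟩ := exists_rep (c 0)
    refine ⟨.hole S, fun q => ?_⟩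
    simp [collapse, Ctx.qfill, Ctx.erase, Ctx.botOut, ← hS, erase_mk, botOut_mk]
  | succ n ih =>
    have hpn := hp.mono (Nat.le_succ n)
    rcases Nat.lt_or_ge n x with h | h
    -- The hole is in the last node: take the context of its parent and push the hole into a new
    -- bracket.
    · obtain rfl : x = n + 1 := by omega
      obtain ⟨C, hC⟩ := ih hpn c (Nat.lt_succ_iff.1 (hp (n + 1) (by omega) le_rfl))
      obtain ⟨S, hS⟩ := exists_rep (c (n + 1))
      have key : ∀ (d : ℕ → QSeq α) q, collapse par (n + 1) (d + Pi.single (n + 1) q) =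
          collapse par n (d + Pi.single (par (n + 1)) (brack (d (n + 1) + q))) := by
        intro d q
        rw [collapse]
        refine collapse_congr (fun _ _ _ => rfl) fun k hk => ?_
        simp [Pi.single_eq_of_ne (show k ≠ n + 1 by omega)]
      refine ⟨C.push S, fun q => ?_⟩
      rw [key, key, key, Ctx.erase_push, Ctx.botOut_push]
      simp only [Ctx.qfill_push, ← erase_mk, ← botOut_mk, hS]
      exact ⟨(hC _).1, (hC _).2.1, (hC _).2.2⟩
    -- The hole is elsewhere: the last node is mere content of its parent, and is folded first.
    · obtain ⟨C, hC⟩ := ih hpn (c + Pi.single (par (n + 1)) (brack (c (n + 1)))) h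
      have key : ∀ (d : ℕ → QSeq α) q, collapse par (n + 1) (d + Pi.single x q) =
          collapse par n (d + Pi.single (par (n + 1)) (brack (d (n + 1))) + Pi.single x q) := by
        intro d q
        rw [collapse, add_right_comm]
        simp [Pi.single_eq_of_ne (show n + 1 ≠ x by omega)]
      refine ⟨C, fun q => ?_⟩
      rw [key, key, key]
      simpa only [comp_add_single, erase_brack, botOut_brack, Function.comp_apply] using hC q

/-- A node of a tree and one of its children. -/
theorem exists_ctx_child {par : ℕ → ℕ} {n : ℕ} (hp : IsParent par n) (c : ℕ → QSeq α) {y : ℕ}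
    (hy : 1 ≤ y) (hyn : y ≤ n) : ∃ (C : Ctx α) (E : NSeq α), ∀ q q',
      collapse par n (c + Pi.single (par y) q + Pi.single y q') =
        C.qfill (q + brack (q' + mk E)) ∧
      collapse par n (botOut ∘ c + Pi.single (par y) q + Pi.single y q') =
        C.botOut.qfill (q + brack (q' + mk E.botOut)) := by
  induction n generalizing c y with
  | zero => omega
  | succ n ih =>
    have hpn := hp.mono (Nat.le_succ n)
    have hpy := hp y hy hyn
    rcases Nat.lt_or_ge n y with h | h
    · obtain rfl : y = n + 1 := by omega
      obtain ⟨C, hC⟩ := exists_ctx hpn c (Nat.lt_succ_iff.1 hpy)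
      obtain ⟨S, hS⟩ := exists_rep (c (n + 1))
      have key : ∀ (d : ℕ → QSeq α) q q',
          collapse par (n + 1) (d + Pi.single (par (n + 1)) q + Pi.single (n + 1) q') =
          collapse par n (d + Pi.single (par (n + 1)) (q + brack (q' + d (n + 1)))) := by
        intro d q q'
        rw [collapse]
        refine collapse_congr (fun _ _ _ => rfl) fun k hk => ?_
        simp [Pi.single_eq_of_ne (show k ≠ n + 1 by omega),
          Pi.single_eq_of_ne (show n + 1 ≠ par (n + 1) by omega), Pi.single_add, add_assoc,
          add_comm q']
      refine ⟨C, S, fun q q' => ?_⟩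
      rw [key, key, ← botOut_mk, hS]
      exact ⟨(hC _).1, (hC _).2.2⟩
    · obtain ⟨C, E, hC⟩ := ih hpn (c + Pi.single (par (n + 1)) (brack (c (n + 1)))) hy h
      have key : ∀ (d : ℕ → QSeq α) q q',
          collapse par (n + 1) (d + Pi.single (par y) q + Pi.single y q') =
          collapse par n (d + Pi.single (par (n + 1)) (brack (d (n + 1))) +
            Pi.single (par y) q + Pi.single y q') := by
        intro d q q'
        rw [collapse]
        simp [Pi.single_eq_of_ne (show n + 1 ≠ y by omega),
          Pi.single_eq_of_ne (show n + 1 ≠ par y by omega)]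
        congr 1
        abel
      refine ⟨C, E, fun q q' => ?_⟩
      rw [key, key]
      simpa only [comp_add_single, botOut_brack, Function.comp_apply] using hC q q'

end Collapse


open QSeq

variable {α : Type*}

theorem QSeq.prv_step {r : Rule} {ps : List (NSeq α)} {S : NSeq α} {q : QSeq α} (h : Inst r ps S)
    (hr : r ≠ .icut ∧ r ≠ .ccut) (hq : q = mk S) (hp : ∀ T ∈ ps, Prv (mk T)) : Prv q :=
  hq ▸ prv_of_inst h hr hp

/-! ### Worlds -/

/-- The class of a multiset of inputs; the mark `true` stands for left inputs. -/
def msQ : Multiset (Bool × Formula α) →+ QSeq α :=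
  Multiset.sumAddMonoidHom.comp
    (Multiset.mapAddMonoidHom fun s => if s.1 then QSeq.left s.2 else QSeq.right s.2)

@[simp] theorem msQ_left (A : Formula α) : msQ {(true, A)} = QSeq.left A := by simp [msQ]
@[simp] theorem msQ_right (A : Formula α) : msQ {(false, A)} = QSeq.right A := by simp [msQ]

theorem map_msQ (f : QSeq α →+ QSeq α) (hl : ∀ A, f (QSeq.left A) = QSeq.left A)
    (hr : ∀ A, f (QSeq.right A) = QSeq.right A) (t : Multiset (Bool × Formula α)) :
    f (msQ t) = msQ t := by
  induction t using Multiset.induction_on with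
  | empty => simp
  | cons s t ih =>
    rw [← Multiset.singleton_add, map_add, map_add, ih]
    obtain ⟨b, A⟩ := s
    cases b <;> simp [hl, hr]

@[simp] theorem erase_msQ (t : Multiset (Bool × Formula α)) : QSeq.erase (msQ t) = msQ t :=
  map_msQ _ erase_left erase_right t

@[simp] theorem botOut_msQ (t : Multiset (Bool × Formula α)) : QSeq.botOut (msQ t) = msQ t :=
  map_msQ _ botOut_left botOut_right t

@[simp] theorem outs_msQ (t : Multiset (Bool × Formula α)) : QSeq.outs (msQ t) = 0 := by
  induction t using Multiset.induction_on with
  | empty => simp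
  | cons s t ih =>
    rw [← Multiset.singleton_add, map_add, map_add, ih]
    obtain ⟨b, A⟩ := s
    cases b <;> simp

/-- The classes of the contents of the nodes. -/
def cont (m : ℕ → Multiset (Bool × Formula α)) : ℕ → QSeq α := fun i => msQ (m i)

theorem cont_add_single (m : ℕ → Multiset (Bool × Formula α)) (x : ℕ)
    (t : Multiset (Bool × Formula α)) :
    cont (m + Pi.single x t) = cont m + Pi.single x (msQ t) := by
  funext i
  by_cases h : i = x
  · subst h; simp [cont]
  · simp [cont, h]

theorem map_cont_add_single (f : QSeq α →+ QSeq α) (hf : ∀ t, f (msQ t) = msQ t)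
    (m : ℕ → Multiset (Bool × Formula α)) (z : ℕ) (q : QSeq α) :
    f ∘ (cont m + Pi.single z q) = cont m + Pi.single z (f q) := by
  rw [comp_add_single]
  congr 1
  funext i
  exact hf _

/-- A world is a finite tree of multisets of inputs, with nodes `0, …, n`. -/
structure World (α : Type*) where
  n : ℕ
  par : ℕ → ℕ
  m : ℕ → Multiset (Bool × Formula α)
  isParent : IsParent par n
  supp : ∀ i, n < i → m i = 0

namespace World

/-- The full sequent obtained by adding the output `A` at the node `z`. -/
def seq (Λ : World α) (z : ℕ) (A : Formula α) : QSeq α :=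
  collapse Λ.par Λ.n (cont Λ.m + Pi.single z (QSeq.out A))

/-- The world proves the output `A` at the node `z`. -/
def Proves (Λ : World α) (z : ℕ) (A : Formula α) : Prop := QSeq.Prv (Λ.seq z A)

/-- The edges of the tree. -/
def R (Λ : World α) (x y : ℕ) : Prop := 1 ≤ y ∧ y ≤ Λ.n ∧ Λ.par y = x

theorem R.lt {Λ : World α} {x y : ℕ} (h : Λ.R x y) : x < y := h.2.2 ▸ Λ.isParent y h.1 h.2.1

theorem R.le_left {Λ : World α} {x y : ℕ} (h : Λ.R x y) : x ≤ Λ.n := h.lt.le.trans h.2.1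

open Classical in
/-- The contents without one occurrence of `s` at `x`. -/
noncomputable def rest (Λ : World α) (x : ℕ) (s : Bool × Formula α) : ℕ → Multiset (Bool × Formula α) :=
  Function.update Λ.m x ((Λ.m x).erase s)

theorem rest_add {Λ : World α} {x : ℕ} {s : Bool × Formula α} (h : s ∈ Λ.m x) :
    Λ.rest x s + Pi.single x {s} = Λ.m := by
  classical
  funext i
  by_cases hi : i = x
  · subst hi
    simp only [rest, Pi.add_apply, Function.update_self, Pi.single_eq_same]
    rw [add_comm, Multiset.singleton_add, Multiset.cons_erase h]
  · simp [rest, hi]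

theorem rest_supp (Λ : World α) (x : ℕ) (s : Bool × Formula α) (i : ℕ) (hi : Λ.n < i) :
    Λ.rest x s i = 0 := by
  classical
  by_cases h : i = x
  · subst h; simp [rest, Λ.supp i hi]
  · simp [rest, h, Λ.supp i hi]

/-- Replace an occurrence of `s` at `x` by `t`. -/
noncomputable def repl (Λ : World α) {x : ℕ} (hx : x ≤ Λ.n) (s : Bool × Formula α)
    (t : Multiset (Bool × Formula α)) : World α where
  n := Λ.n
  par := Λ.par
  m := Λ.rest x s + Pi.single x t
  isParent := Λ.isParent
  supp i hi := by simp [Λ.rest_supp x s i hi, show i ≠ x by omega]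

/-- Add `t` at `x`. -/
def add (Λ : World α) {x : ℕ} (hx : x ≤ Λ.n) (t : Multiset (Bool × Formula α)) : World α where
  n := Λ.n
  par := Λ.par
  m := Λ.m + Pi.single x t
  isParent := Λ.isParent
  supp i hi := by simp [Λ.supp i hi, show i ≠ x by omega]

/-- Add a child of `x` with content `t`. -/
def child (Λ : World α) {x : ℕ} (hx : x ≤ Λ.n) (t : Multiset (Bool × Formula α)) : World α where
  n := Λ.n + 1
  par := Function.update Λ.par (Λ.n + 1) x
  m := Λ.m + Pi.single (Λ.n + 1) t
  isParent k h1 h2 := by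
    by_cases h : k = Λ.n + 1
    · subst h; simp; omega
    · simpa [h] using Λ.isParent k h1 (by omega)
  supp i hi := by simp [Λ.supp i (by omega), show i ≠ Λ.n + 1 by omega]

theorem repl_self {Λ : World α} {x : ℕ} (hx : x ≤ Λ.n) {s : Bool × Formula α} (h : s ∈ Λ.m x) :
    Λ.repl hx s {s} = Λ := by
  have := rest_add h
  cases Λ
  simp only [repl, mk.injEq, true_and]
  exact this

/-- The new child has the largest index, so `collapse` folds it first. Because `supp` makes the old
contents vanish beyond `n`, its bracket holds only `t` and the part of `d` placed there. -/
theorem collapse_child (Λ : World α) {x : ℕ} (hx : x ≤ Λ.n) (t : Multiset (Bool × Formula α))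
    (d : ℕ → QSeq α) :
    collapse (Λ.child hx t).par (Λ.child hx t).n (cont (Λ.child hx t).m + d) =
      collapse Λ.par Λ.n (cont Λ.m + d + Pi.single x (QSeq.brack (msQ t + d (Λ.n + 1)))) := by
  have h0 : cont Λ.m (Λ.n + 1) = 0 := by simp [cont, Λ.supp (Λ.n + 1) (by omega)]
  simp only [child, collapse, cont_add_single]
  refine collapse_congr (fun k _ hk => ?_) fun k hk => ?_
  · simp [show k ≠ Λ.n + 1 by omega]
  · simp [h0, show k ≠ Λ.n + 1 by omega]

theorem outs_seq {Λ : World α} {z : ℕ} (hz : z ≤ Λ.n) (A : Formula α) :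
    QSeq.outs (Λ.seq z A) = 1 := by
  have h : ∀ i, QSeq.outs ((Pi.single z (QSeq.out A) : ℕ → QSeq α) i) = if i = z then 1 else 0 := by
    intro i
    by_cases h : i = z
    · subst h; simp
    · simp [h]
  rw [seq, outs_collapse Λ.isParent]
  simp [cont, h]
  omega

/-- A node as a hole, for sequents with the output at an arbitrary node. -/
theorem exists_full_hole (Λ : World α) {x z : ℕ} (hx : x ≤ Λ.n) (hz : z ≤ Λ.n)
    (s : Bool × Formula α) (D : Formula α) : ∃ C : Ctx α, C.IsFull ∧
      (∀ t, (Λ.repl hx s t).seq z D = C.qfill (msQ t)) ∧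
      (∀ t, (Λ.repl hx s t).seq z .bot = C.botOut.qfill (msQ t)) ∧
      (∀ t B, (Λ.repl hx s t).seq x B = C.erase.qfill (msQ t + QSeq.out B)) ∧
      (∀ t, ((Λ.repl hx s 0).child hx t).seq z D = C.qfill (QSeq.brack (msQ t))) ∧
      (∀ t, ((Λ.repl hx s 0).child hx t).seq z .bot = C.botOut.qfill (QSeq.brack (msQ t))) := by
  -- The output is put into the contents before the hole is opened. A single `C` then serves three
  -- purposes: itself for the output `D`, `C.botOut` for `⊥`, and `C.erase` for an output moved into
  -- the hole.
  obtain ⟨C, hC⟩ := exists_ctx Λ.isParent (cont (Λ.rest x s) + Pi.single z (QSeq.out D)) hx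
  have hE := map_cont_add_single QSeq.erase erase_msQ (Λ.rest x s) z (QSeq.out D)
  have hB := map_cont_add_single QSeq.botOut botOut_msQ (Λ.rest x s) z (QSeq.out D)
  rw [erase_out, Pi.single_zero, add_zero] at hE
  rw [hE, hB, botOut_out] at hC
  have h1 : ∀ t A, (Λ.repl hx s t).seq z A = collapse Λ.par Λ.n
      (cont (Λ.rest x s) + Pi.single z (QSeq.out A) + Pi.single x (msQ t)) := by
    intro t A
    rw [seq, repl, cont_add_single, add_right_comm]
  have h2 : ∀ t A, ((Λ.repl hx s 0).child hx t).seq z A = collapse Λ.par Λ.n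
      (cont (Λ.rest x s) + Pi.single z (QSeq.out A) + Pi.single x (QSeq.brack (msQ t))) := by
    intro t A
    refine (collapse_child (Λ.repl hx s 0) hx t _).trans ?_
    rw [Pi.single_eq_of_ne (by simp only [repl]; omega), add_zero]
    simp [repl]
  refine ⟨C, ?_, fun t => ?_, fun t => ?_, fun t B => ?_, fun t => ?_, fun t => ?_⟩
  -- The full sequent has one output and the filling has none, so the context carries it.
  · have h := outs_seq (Λ := Λ.repl hx s 0) hz D
    rw [h1, (hC _).1, Ctx.outs_qfill] at h
    simpa [Ctx.IsFull] using h
  · rw [h1, (hC _).1]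
  · rw [h1, (hC _).2.2]
  · rw [seq, repl, cont_add_single, add_assoc, ← Pi.single_add, (hC _).2.1]
  · rw [h2, (hC _).1]
  · rw [h2, (hC _).2.2]

/-- A node as a hole, for sequents with the output in the hole. -/
theorem exists_input_hole (Λ : World α) {x : ℕ} (hx : x ≤ Λ.n) : ∃ C : Ctx α, C.IsInput ∧
      (∀ B, Λ.seq x B = C.qfill (QSeq.out B)) ∧
      (∀ t B, (Λ.add hx t).seq x B = C.qfill (msQ t + QSeq.out B)) ∧
      (∀ B, (Λ.child hx 0).seq (Λ.n + 1) B = C.qfill (QSeq.brack (QSeq.out B))) := by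
  obtain ⟨C, hC⟩ := exists_ctx Λ.isParent (cont Λ.m) hx
  have h1 : ∀ B, Λ.seq x B = C.qfill (QSeq.out B) := fun B => (hC _).1
  refine ⟨C, ?_, h1, fun t B => ?_, fun B => ?_⟩
  · have h := outs_seq hx (.bot : Formula α)
    rw [h1, Ctx.outs_qfill] at h
    simpa [Ctx.IsInput] using h
  · rw [seq, add, cont_add_single, add_assoc, ← Pi.single_add, (hC _).1]
  · rw [seq, collapse_child, Pi.single_eq_same, map_zero, zero_add, ← (hC _).1]
    refine collapse_congr (fun _ _ _ => rfl) fun k hk => ?_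
    simp [show k ≠ Λ.n + 1 by omega]

/-- A node and a child as a double hole, for sequents with the output at an arbitrary node. -/
theorem exists_full_hole_child (Λ : World α) {x y z : ℕ} (h : Λ.R x y) (hz : z ≤ Λ.n)
    (s : Bool × Formula α) (hs : s ∈ Λ.m x) (D : Formula α) :
    ∃ (C : Ctx α) (E : NSeq α), C.outs + E.outs = 1 ∧
      (Λ.seq z D = C.qfill (msQ {s} + QSeq.brack (QSeq.mk E))) ∧
      (∀ t, (Λ.add h.2.1 t).seq z D = C.qfill (msQ {s} + QSeq.brack (msQ t + QSeq.mk E))) ∧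
      (Λ.seq z .bot = C.botOut.qfill (msQ {s} + QSeq.brack (QSeq.mk E.botOut))) ∧
      (∀ t, (Λ.add h.2.1 t).seq z .bot =
        C.botOut.qfill (msQ {s} + QSeq.brack (msQ t + QSeq.mk E.botOut))) := by
  obtain ⟨C, E, hC⟩ := exists_ctx_child Λ.isParent
    (cont (Λ.rest x s) + Pi.single z (QSeq.out D)) h.1 h.2.1
  have hB := map_cont_add_single QSeq.botOut botOut_msQ (Λ.rest x s) z (QSeq.out D)
  rw [hB, botOut_out, h.2.2] at hC
  have h1 : ∀ t A, (Λ.add h.2.1 t).seq z A = collapse Λ.par Λ.n (cont (Λ.rest x s) +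
      Pi.single z (QSeq.out A) + Pi.single x (msQ {s}) + Pi.single y (msQ t)) := by
    intro t A
    rw [seq, add, cont_add_single]
    have hm : cont Λ.m = cont (Λ.rest x s) + Pi.single x (msQ {s}) := by
      rw [← cont_add_single, rest_add hs]
    simp only [hm]
    congr 1
    abel
  have h2 : ∀ A, Λ.seq z A = (Λ.add h.2.1 0).seq z A := by
    intro A
    simp [seq, add]
  refine ⟨C, E, ?_, ?_, fun t => ?_, ?_, fun t => ?_⟩
  · have h := outs_seq (Λ := Λ.add h.2.1 0) hz D
    rw [h1, (hC _ _).1, Ctx.outs_qfill] at h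
    simpa [QSeq.outs_mk] using h
  · rw [h2, h1, (hC _ _).1]; simp
  · rw [h1, (hC _ _).1]
  · rw [h2, h1, (hC _ _).2]; simp
  · rw [h1, (hC _ _).2]

/-- A node and a child as a double hole, for sequents with the output in the hole. -/
theorem exists_input_hole_child (Λ : World α) {x y : ℕ} (h : Λ.R x y) :
    ∃ (C : Ctx α) (E : NSeq α), C.IsInput ∧ E.IsInput ∧
      (∀ B, Λ.seq x B = C.qfill (QSeq.out B + QSeq.brack (QSeq.mk E))) ∧
      (∀ B, Λ.seq y B = C.qfill (QSeq.brack (QSeq.out B + QSeq.mk E))) := by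
  obtain ⟨C, E, hC⟩ := exists_ctx_child Λ.isParent (cont Λ.m) h.1 h.2.1
  rw [h.2.2] at hC
  have h1 : ∀ B, Λ.seq x B = C.qfill (QSeq.out B + QSeq.brack (QSeq.mk E)) := by
    intro B
    have := (hC (QSeq.out B) 0).1
    rwa [Pi.single_zero, add_zero, zero_add] at this
  have h2 : ∀ B, Λ.seq y B = C.qfill (QSeq.brack (QSeq.out B + QSeq.mk E)) := by
    intro B
    have := (hC 0 (QSeq.out B)).1
    rwa [Pi.single_zero, add_zero, zero_add] at this
  have ho := outs_seq h.le_left (.bot : Formula α)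
  rw [h1, Ctx.outs_qfill] at ho
  simp only [map_add, outs_out, outs_brack, QSeq.outs_mk] at ho
  exact ⟨C, E, by simp only [Ctx.IsInput]; omega, by simp only [NSeq.IsInput]; omega, h1, h2⟩

/-! ### The rules on labelled trees -/

section Rules

variable {Λ : World α} {x y z : ℕ} {A B D P N : Formula α} {p : α}

/-- The pattern for the left and right input rules: `repl_self` exhibits the principal formula as
the content of a hole, and the hole lemma turns premises and conclusion into fillings of one
context. The node `z` of the output stays arbitrary. -/
theorem proves_andL (hx : x ≤ Λ.n) (hz : z ≤ Λ.n) (hs : (true, .and A B) ∈ Λ.m x)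
    (h : (Λ.repl hx (true, .and A B) ({(true, A)} + {(true, B)})).Proves z D) : Λ.Proves z D := by
  obtain ⟨C, hC, h1, -⟩ := Λ.exists_full_hole hx hz (true, .and A B) D
  rw [Proves, h1, map_add] at h
  rw [Proves, ← repl_self hx hs, h1]
  exact prv_step (.andL C A B hC) (by simp) (by simp [Ctx.mk_fill, QSeq.left])
    (by simpa [Ctx.mk_fill, QSeq.mk_comma, QSeq.left] using h)

theorem proves_orIL (hx : x ≤ Λ.n) (hz : z ≤ Λ.n) (hs : (true, .orI A B) ∈ Λ.m x)
    (hA : (Λ.repl hx (true, .orI A B) {(true, A)}).Proves z D)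
    (hB : (Λ.repl hx (true, .orI A B) {(true, B)}).Proves z D) : Λ.Proves z D := by
  obtain ⟨C, hC, h1, -⟩ := Λ.exists_full_hole hx hz (true, .orI A B) D
  rw [Proves, h1] at hA hB
  rw [Proves, ← repl_self hx hs, h1]
  simp only [msQ_left] at hA hB
  exact prv_step (.orIL C A B hC) (by simp) (by simp [Ctx.mk_fill, QSeq.left])
    (by simpa [Ctx.mk_fill, QSeq.left] using ⟨hA, hB⟩)

theorem proves_botL (hx : x ≤ Λ.n) (hz : z ≤ Λ.n) (hs : (true, .bot) ∈ Λ.m x) :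
    Λ.Proves z D := by
  obtain ⟨C, hC, h1, -⟩ := Λ.exists_full_hole hx hz (true, .bot) D
  rw [Proves, ← repl_self hx hs, h1]
  exact prv_step (.botL C hC) (by simp) (by simp [Ctx.mk_fill, QSeq.left]) (by simp)

theorem proves_impIL (hx : x ≤ Λ.n) (hz : z ≤ Λ.n) (hs : (true, .impI A B) ∈ Λ.m x)
    (hA : Λ.Proves x A) (hB : (Λ.repl hx (true, .impI A B) {(true, B)}).Proves z D) :
    Λ.Proves z D := by
  obtain ⟨C, hC, h1, -, h3, -⟩ := Λ.exists_full_hole hx hz (true, .impI A B) D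
  rw [Proves, ← repl_self hx hs, h3] at hA
  rw [Proves, h1] at hB
  rw [Proves, ← repl_self hx hs, h1]
  simp only [msQ_left] at hA hB
  exact prv_step (.impIL C A B hC) (by simp) (by simp [Ctx.mk_fill, QSeq.left])
    (by simpa [Ctx.mk_fill, QSeq.left, QSeq.out, QSeq.mk_comma] using ⟨hA, hB⟩)

theorem proves_negL (hx : x ≤ Λ.n) (hz : z ≤ Λ.n) (hs : (true, .neg A) ∈ Λ.m x)
    (hA : Λ.Proves x A) : Λ.Proves z .bot := by
  obtain ⟨C, hC, -, h2, h3, -⟩ := Λ.exists_full_hole hx hz (true, .neg A) .bot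
  rw [Proves, ← repl_self hx hs, h3] at hA
  rw [Proves, ← repl_self hx hs, h2]
  exact prv_step (.negL C A hC) (by simp) (by simp [Ctx.mk_fill, QSeq.left])
    (by simpa [Ctx.mk_fill, QSeq.left, QSeq.out, QSeq.mk_comma] using hA)

theorem proves_negT (hx : x ≤ Λ.n) (hz : z ≤ Λ.n) (hs : (false, .neg A) ∈ Λ.m x)
    (hA : (Λ.repl hx (false, .neg A) {(true, A)}).Proves z .bot) : Λ.Proves z .bot := by
  obtain ⟨C, hC, -, h2, -⟩ := Λ.exists_full_hole hx hz (false, .neg A) .bot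
  rw [Proves, h2] at hA
  rw [Proves, ← repl_self hx hs, h2]
  exact prv_step (.negT C A hC) (by simp) (by simp [Ctx.mk_fill, QSeq.right])
    (by simpa [Ctx.mk_fill, QSeq.left] using hA)

theorem proves_impCL (hx : x ≤ Λ.n) (hz : z ≤ Λ.n) (hs : (true, .impC A B) ∈ Λ.m x)
    (hA : Λ.Proves x A) (hB : (Λ.repl hx (true, .impC A B) {(true, B)}).Proves z .bot) :
    Λ.Proves z .bot := by
  obtain ⟨C, hC, -, h2, h3, -⟩ := Λ.exists_full_hole hx hz (true, .impC A B) .bot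
  rw [Proves, ← repl_self hx hs, h3] at hA
  rw [Proves, h2] at hB
  rw [Proves, ← repl_self hx hs, h2]
  simp only [msQ_left] at hA hB
  exact prv_step (.impCL C A B hC) (by simp) (by simp [Ctx.mk_fill, QSeq.left])
    (by simpa [Ctx.mk_fill, QSeq.left, QSeq.out, QSeq.mk_comma] using ⟨hA, hB⟩)

theorem proves_impCT (hx : x ≤ Λ.n) (hz : z ≤ Λ.n) (hs : (false, .impC A B) ∈ Λ.m x)
    (h : (Λ.repl hx (false, .impC A B) ({(true, A)} + {(false, B)})).Proves z .bot) :
    Λ.Proves z .bot := by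
  obtain ⟨C, hC, -, h2, -⟩ := Λ.exists_full_hole hx hz (false, .impC A B) .bot
  rw [Proves, h2, map_add] at h
  rw [Proves, ← repl_self hx hs, h2]
  exact prv_step (.impCT C A B hC) (by simp) (by simp [Ctx.mk_fill, QSeq.right])
    (by simpa [Ctx.mk_fill, QSeq.mk_comma, QSeq.left, QSeq.right] using h)

theorem proves_orCL (hx : x ≤ Λ.n) (hz : z ≤ Λ.n) (hs : (true, .orC A B) ∈ Λ.m x)
    (hA : (Λ.repl hx (true, .orC A B) {(true, A)}).Proves z .bot)
    (hB : (Λ.repl hx (true, .orC A B) {(true, B)}).Proves z .bot) : Λ.Proves z .bot := by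
  obtain ⟨C, hC, -, h2, -⟩ := Λ.exists_full_hole hx hz (true, .orC A B) .bot
  rw [Proves, h2] at hA hB
  rw [Proves, ← repl_self hx hs, h2]
  simp only [msQ_left] at hA hB
  exact prv_step (.orCL C A B hC) (by simp) (by simp [Ctx.mk_fill, QSeq.left])
    (by simpa [Ctx.mk_fill, QSeq.left] using ⟨hA, hB⟩)

theorem proves_orCT (hx : x ≤ Λ.n) (hz : z ≤ Λ.n) (hs : (false, .orC A B) ∈ Λ.m x)
    (h : (Λ.repl hx (false, .orC A B) ({(false, A)} + {(false, B)})).Proves z .bot) :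
    Λ.Proves z .bot := by
  obtain ⟨C, hC, -, h2, -⟩ := Λ.exists_full_hole hx hz (false, .orC A B) .bot
  rw [Proves, h2, map_add] at h
  rw [Proves, ← repl_self hx hs, h2]
  exact prv_step (.orCT C A B hC) (by simp) (by simp [Ctx.mk_fill, QSeq.right])
    (by simpa [Ctx.mk_fill, QSeq.mk_comma, QSeq.right] using h)

theorem proves_atomCL (hx : x ≤ Λ.n) (hz : z ≤ Λ.n) (hs : (true, .atomC p) ∈ Λ.m x)
    (h : (Λ.repl hx (true, .atomC p) {(true, .atomI p)}).Proves z .bot) : Λ.Proves z .bot := by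
  obtain ⟨C, hC, -, h2, -⟩ := Λ.exists_full_hole hx hz (true, .atomC p) .bot
  rw [Proves, h2] at h
  rw [Proves, ← repl_self hx hs, h2]
  exact prv_step (.atomCL C p hC) (by simp) (by simp [Ctx.mk_fill, QSeq.left])
    (by simpa [Ctx.mk_fill, QSeq.left] using h)

theorem proves_atomCT (hx : x ≤ Λ.n) (hz : z ≤ Λ.n) (hs : (false, .atomC p) ∈ Λ.m x)
    (h : (Λ.repl hx (false, .atomC p) {(false, .atomI p)}).Proves z .bot) : Λ.Proves z .bot := by
  obtain ⟨C, hC, -, h2, -⟩ := Λ.exists_full_hole hx hz (false, .atomC p) .bot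
  rw [Proves, h2] at h
  rw [Proves, ← repl_self hx hs, h2]
  exact prv_step (.atomCT C p hC) (by simp) (by simp [Ctx.mk_fill, QSeq.right])
    (by simpa [Ctx.mk_fill, QSeq.right] using h)

theorem proves_diaIL (hx : x ≤ Λ.n) (hz : z ≤ Λ.n) (hs : (true, .diaI A) ∈ Λ.m x)
    (h : ((Λ.repl hx (true, .diaI A) 0).child hx {(true, A)}).Proves z D) : Λ.Proves z D := by
  obtain ⟨C, hC, h1, -, -, h4, -⟩ := Λ.exists_full_hole hx hz (true, .diaI A) D
  rw [Proves, h4] at h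
  rw [Proves, ← repl_self hx hs, h1]
  exact prv_step (.diaIL C A hC) (by simp) (by simp [Ctx.mk_fill, QSeq.left])
    (by simpa [Ctx.mk_fill, QSeq.left, QSeq.mk_brack] using h)

theorem proves_diaCL (hx : x ≤ Λ.n) (hz : z ≤ Λ.n) (hs : (true, .diaC A) ∈ Λ.m x)
    (h : ((Λ.repl hx (true, .diaC A) 0).child hx {(true, A)}).Proves z .bot) :
    Λ.Proves z .bot := by
  obtain ⟨C, hC, -, h2, -, -, h5⟩ := Λ.exists_full_hole hx hz (true, .diaC A) .bot
  rw [Proves, h5] at h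
  rw [Proves, ← repl_self hx hs, h2]
  exact prv_step (.diaCL C A hC) (by simp) (by simp [Ctx.mk_fill, QSeq.left])
    (by simpa [Ctx.mk_fill, QSeq.left, QSeq.mk_brack] using h)

theorem proves_boxL (hR : Λ.R x y) (hz : z ≤ Λ.n) (hs : (true, .box A) ∈ Λ.m x)
    (h : (Λ.add hR.2.1 {(true, A)}).Proves z D) : Λ.Proves z D := by
  obtain ⟨C, E, hC, h1, h2, -⟩ := Λ.exists_full_hole_child hR hz _ hs D
  rw [Proves, h2] at h
  rw [Proves, h1]
  exact prv_step (.boxL C A E hC) (by simp)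
    (by simp [Ctx.mk_fill, QSeq.left, QSeq.mk_comma, QSeq.mk_brack])
    (by simpa [Ctx.mk_fill, QSeq.left, QSeq.mk_comma, QSeq.mk_brack] using h)

theorem proves_diaCT (hR : Λ.R x y) (hz : z ≤ Λ.n) (hs : (false, .diaC A) ∈ Λ.m x)
    (h : (Λ.add hR.2.1 {(false, A)}).Proves z .bot) : Λ.Proves z .bot := by
  obtain ⟨C, E, hC, -, -, h1, h2⟩ := Λ.exists_full_hole_child hR hz _ hs .bot
  rw [Proves, h2] at h
  rw [Proves, h1]
  exact prv_step (.diaCT C A E hC) (by simp)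
    (by simp [Ctx.mk_fill, QSeq.right, QSeq.mk_comma, QSeq.mk_brack])
    (by simpa [Ctx.mk_fill, QSeq.right, QSeq.mk_comma, QSeq.mk_brack] using h)

theorem proves_init (hx : x ≤ Λ.n) (hs : (true, A) ∈ Λ.m x) : Λ.Proves x A := by
  obtain ⟨C, hC, -, -, h3, -⟩ := Λ.exists_full_hole hx hx (true, A) A
  have hE : C.erase.IsInput := by
    have h := outs_seq (Λ := Λ.repl hx (true, A) {(true, A)}) hx A
    rw [h3, Ctx.outs_qfill] at h
    simpa [Ctx.IsInput] using h
  rw [Proves, ← repl_self hx hs, h3]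
  exact prv_step (.ginit C.erase A hE) (by simp)
    (by simp [Ctx.mk_fill, QSeq.left, QSeq.out, QSeq.mk_comma]) (by simp)

theorem proves_der (hx : x ≤ Λ.n) (hz : z ≤ Λ.n) (hP : P.Positive) (hs : (false, P) ∈ Λ.m x)
    (h : Λ.Proves x P) : Λ.Proves z .bot := by
  obtain ⟨C, hC, -, h2, h3, -⟩ := Λ.exists_full_hole hx hz (false, P) .bot
  rw [Proves, ← repl_self hx hs, h3] at h
  rw [Proves, ← repl_self hx hs, h2]
  exact prv_step (.der C P hC hP) (by simp) (by simp [Ctx.mk_fill, QSeq.right])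
    (by simpa [Ctx.mk_fill, QSeq.right, QSeq.out, QSeq.mk_comma] using h)

theorem proves_store (hx : x ≤ Λ.n) (hN : N.Negative)
    (h : (Λ.add hx {(false, N)}).Proves x .bot) : Λ.Proves x N := by
  obtain ⟨C, hC, h1, h2, -⟩ := Λ.exists_input_hole hx
  rw [Proves, h2] at h
  rw [Proves, h1]
  exact prv_step (.store C N hC hN) (by simp) (by simp [Ctx.mk_fill, QSeq.out])
    (by simpa [Ctx.mk_fill, QSeq.right, QSeq.out, QSeq.mk_comma] using h)

theorem proves_weak (hz : z ≤ Λ.n) (h : Λ.Proves z .bot) : Λ.Proves z D := by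
  obtain ⟨S, hS⟩ := exists_rep (Λ.seq z D)
  have ho := outs_seq hz D
  have hbs : QSeq.botOut (Λ.seq z D) = Λ.seq z .bot := by
    rw [seq, map_collapse _ botOut_brack, map_cont_add_single _ botOut_msQ, botOut_out, seq]
  rw [← hS, QSeq.outs_mk] at ho
  rw [Proves, ← hbs, ← hS] at h
  exact prv_step (.weak S ho) (by simp) hS.symm (by simpa [QSeq.botOut_mk] using h)

theorem proves_andR (hx : x ≤ Λ.n) (hA : Λ.Proves x A) (hB : Λ.Proves x B) :
    Λ.Proves x (.and A B) := by
  obtain ⟨C, hC, h1, -⟩ := Λ.exists_input_hole hx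
  rw [Proves, h1] at *
  exact prv_step (.andR C A B hC) (by simp) (by simp [Ctx.mk_fill, QSeq.out])
    (by simpa [Ctx.mk_fill, QSeq.out] using ⟨hA, hB⟩)

theorem proves_orIR₁ (hx : x ≤ Λ.n) (hA : Λ.Proves x A) : Λ.Proves x (.orI A B) := by
  obtain ⟨C, hC, h1, -⟩ := Λ.exists_input_hole hx
  rw [Proves, h1] at *
  exact prv_step (.orIR₁ C A B hC) (by simp) (by simp [Ctx.mk_fill, QSeq.out])
    (by simpa [Ctx.mk_fill, QSeq.out] using hA)

theorem proves_orIR₂ (hx : x ≤ Λ.n) (hB : Λ.Proves x B) : Λ.Proves x (.orI A B) := by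
  obtain ⟨C, hC, h1, -⟩ := Λ.exists_input_hole hx
  rw [Proves, h1] at *
  exact prv_step (.orIR₂ C A B hC) (by simp) (by simp [Ctx.mk_fill, QSeq.out])
    (by simpa [Ctx.mk_fill, QSeq.out] using hB)

theorem proves_impIR (hx : x ≤ Λ.n) (h : (Λ.add hx {(true, A)}).Proves x B) :
    Λ.Proves x (.impI A B) := by
  obtain ⟨C, hC, h1, h2, -⟩ := Λ.exists_input_hole hx
  rw [Proves, h2] at h
  rw [Proves, h1]
  exact prv_step (.impIR C A B hC) (by simp) (by simp [Ctx.mk_fill, QSeq.out])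
    (by simpa [Ctx.mk_fill, QSeq.left, QSeq.out, QSeq.mk_comma] using h)

theorem proves_boxR (hx : x ≤ Λ.n) (h : (Λ.child hx 0).Proves (Λ.n + 1) A) :
    Λ.Proves x (.box A) := by
  obtain ⟨C, hC, h1, -, h3⟩ := Λ.exists_input_hole hx
  rw [Proves, h3] at h
  rw [Proves, h1]
  exact prv_step (.boxR C A hC) (by simp) (by simp [Ctx.mk_fill, QSeq.out])
    (by simpa [Ctx.mk_fill, QSeq.mk_brack, QSeq.out] using h)

theorem proves_diaIR (hR : Λ.R x y) (h : Λ.Proves y A) : Λ.Proves x (.diaI A) := by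
  obtain ⟨C, E, hC, hE, h1, h2⟩ := Λ.exists_input_hole_child hR
  rw [Proves, h2] at h
  rw [Proves, h1]
  exact prv_step (.diaIR C A E hC hE) (by simp)
    (by simp [Ctx.mk_fill, QSeq.out, QSeq.mk_comma, QSeq.mk_brack])
    (by simpa [Ctx.mk_fill, QSeq.out, QSeq.mk_comma, QSeq.mk_brack] using h)

end Rules

end World


namespace World

/-! ### The order of worlds -/

/-- The world contains a formula at a node, or the results of decomposing it by its rule.  The mark
`true` stands for left inputs. -/
def Has (Λ : World α) : Formula α → Bool → ℕ → Prop
  | .atomI p, b, x => (b, .atomI p) ∈ Λ.m x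
  | .atomC p, b, x => (b, .atomC p) ∈ Λ.m x ∨ (b, .atomI p) ∈ Λ.m x
  | .bot, b, x => (b, .bot) ∈ Λ.m x
  -- Alternatives mirror the premises: a conjunction when one premise contains two formulas, a
  -- disjunction when there are two premises. For left implications only `B` counts, as the other
  -- premise keeps the implication. Left `neg`, left `box` and right `diaC` survive their rules, and
  -- right positive formulas survive `D`, so these have membership only.
  | .neg A, true, x => (true, .neg A) ∈ Λ.m x
  | .neg A, false, x => (false, .neg A) ∈ Λ.m x ∨ Has Λ A true x
  | .and A B, true, x => (true, .and A B) ∈ Λ.m x ∨ Has Λ A true x ∧ Has Λ B true x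
  | .and A B, false, x => (false, .and A B) ∈ Λ.m x
  | .orI A B, true, x => (true, .orI A B) ∈ Λ.m x ∨ Has Λ A true x ∨ Has Λ B true x
  | .orI A B, false, x => (false, .orI A B) ∈ Λ.m x
  | .impI A B, true, x => (true, .impI A B) ∈ Λ.m x ∨ Has Λ B true x
  | .impI A B, false, x => (false, .impI A B) ∈ Λ.m x
  | .orC A B, true, x => (true, .orC A B) ∈ Λ.m x ∨ Has Λ A true x ∨ Has Λ B true x
  | .orC A B, false, x => (false, .orC A B) ∈ Λ.m x ∨ Has Λ A false x ∧ Has Λ B false x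
  | .impC A B, true, x => (true, .impC A B) ∈ Λ.m x ∨ Has Λ B true x
  | .impC A B, false, x => (false, .impC A B) ∈ Λ.m x ∨ Has Λ A true x ∧ Has Λ B false x
  | .box A, b, x => (b, .box A) ∈ Λ.m x
  | .diaI A, true, x => (true, .diaI A) ∈ Λ.m x ∨ ∃ y, Λ.R x y ∧ Has Λ A true y
  | .diaI A, false, x => (false, .diaI A) ∈ Λ.m x
  | .diaC A, true, x => (true, .diaC A) ∈ Λ.m x ∨ ∃ y, Λ.R x y ∧ Has Λ A true y
  | .diaC A, false, x => (false, .diaC A) ∈ Λ.m x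

theorem has_of_mem {Λ : World α} {A : Formula α} {b : Bool} {x : ℕ} (h : (b, A) ∈ Λ.m x) :
    Λ.Has A b x := by
  cases A <;> cases b <;> simp [Has, h]

/-- No rule consumes a positive right input; it therefore stays literally present in all extensions,
as an application of `D` requires. -/
theorem mem_of_has {Λ : World α} {P : Formula α} {x : ℕ} (hP : P.Positive)
    (h : Λ.Has P false x) : (false, P) ∈ Λ.m x := by
  cases P <;> simp_all [Has, Formula.Positive, Formula.Negative]

/-- The order of worlds without its closure properties. -/
structure Le (Λ Λ' : World α) : Prop where
  n_le : Λ.n ≤ Λ'.n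
  par_eq : ∀ k, 1 ≤ k → k ≤ Λ.n → Λ'.par k = Λ.par k
  has : ∀ x ≤ Λ.n, ∀ A b, (b, A) ∈ Λ.m x → Λ'.Has A b x

theorem Le.R {Λ Λ' : World α} (h : Le Λ Λ') {x y : ℕ} (hR : Λ.R x y) : Λ'.R x y :=
  ⟨hR.1, hR.2.1.trans h.n_le, (h.par_eq y hR.1 hR.2.1).trans hR.2.2⟩

/-- The order only constrains literal members, but decomposition recurses into subformulas and
children, so induction on the formula extends it to `Has`. This is what makes the order transitive.
-/
theorem Le.mono {Λ Λ' : World α} (h : Le Λ Λ') {A : Formula α} {b : Bool} {x : ℕ}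
    (hx : x ≤ Λ.n) (hA : Λ.Has A b x) : Λ'.Has A b x := by
  induction A generalizing b x with
  | atomI p => exact h.has x hx _ _ hA
  | atomC p =>
    rcases hA with hA | hA
    · exact h.has x hx _ _ hA
    · exact .inr (h.has x hx _ _ hA)
  | bot => exact h.has x hx _ _ hA
  | neg A ih =>
    cases b
    · rcases hA with hA | hA
      · exact h.has x hx _ _ hA
      · exact .inr (ih hx hA)
    · exact h.has x hx _ _ hA
  | and A B ihA ihB =>
    cases b
    · exact h.has x hx _ _ hA
    · rcases hA with hA | hA
      · exact h.has x hx _ _ hA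
      · exact .inr ⟨ihA hx hA.1, ihB hx hA.2⟩
  | orI A B ihA ihB =>
    cases b
    · exact h.has x hx _ _ hA
    · rcases hA with hA | hA | hA
      · exact h.has x hx _ _ hA
      · exact .inr (.inl (ihA hx hA))
      · exact .inr (.inr (ihB hx hA))
  | impI A B ihA ihB =>
    cases b
    · exact h.has x hx _ _ hA
    · rcases hA with hA | hA
      · exact h.has x hx _ _ hA
      · exact .inr (ihB hx hA)
  | orC A B ihA ihB =>
    cases b
    · rcases hA with hA | hA
      · exact h.has x hx _ _ hA
      · exact .inr ⟨ihA hx hA.1, ihB hx hA.2⟩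
    · rcases hA with hA | hA | hA
      · exact h.has x hx _ _ hA
      · exact .inr (.inl (ihA hx hA))
      · exact .inr (.inr (ihB hx hA))
  | impC A B ihA ihB =>
    cases b
    · rcases hA with hA | hA
      · exact h.has x hx _ _ hA
      · exact .inr ⟨ihA hx hA.1, ihB hx hA.2⟩
    · rcases hA with hA | hA
      · exact h.has x hx _ _ hA
      · exact .inr (ihB hx hA)
  | box A ih => exact h.has x hx _ _ hA
  | diaI A ih =>
    cases b
    · exact h.has x hx _ _ hA
    · rcases hA with hA | ⟨y, hR, hA⟩
      · exact h.has x hx _ _ hA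
      · exact .inr ⟨y, h.R hR, ih hR.2.1 hA⟩
  | diaC A ih =>
    cases b
    · exact h.has x hx _ _ hA
    · rcases hA with hA | ⟨y, hR, hA⟩
      · exact h.has x hx _ _ hA
      · exact .inr ⟨y, h.R hR, ih hR.2.1 hA⟩

instance : Preorder (World α) where
  le := Le
  le_refl _ := ⟨le_rfl, fun _ _ _ => rfl, fun _ _ _ _ => has_of_mem⟩
  le_trans _ _ _ h h' := ⟨h.n_le.trans h'.n_le,
    fun k h1 h2 => (h'.par_eq k h1 (h2.trans h.n_le)).trans (h.par_eq k h1 h2),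
    fun x hx A b hA => h'.mono (hx.trans h.n_le) (h.has x hx A b hA)⟩

section Order

variable {Λ Λ' : World α} {A : Formula α} {b : Bool} {x y : ℕ}

theorem n_mono (h : Λ ≤ Λ') : Λ.n ≤ Λ'.n := Le.n_le h

theorem R_mono (h : Λ ≤ Λ') (hR : Λ.R x y) : Λ'.R x y := Le.R h hR

theorem has_mono (h : Λ ≤ Λ') (hx : x ≤ Λ.n) (hA : Λ.Has A b x) : Λ'.Has A b x := Le.mono h hx hA

/-- After removal of one occurrence of `s`, every other input is still a literal member; only `s`
has to be recovered, through its decomposition. -/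
theorem le_of_rest {s : Bool × Formula α} (hn : Λ.n ≤ Λ'.n)
    (hp : ∀ k, 1 ≤ k → k ≤ Λ.n → Λ'.par k = Λ.par k)
    (hm : ∀ i ≤ Λ.n, ∀ u ∈ Λ.rest x s i, u ∈ Λ'.m i) (hs : Λ'.Has s.2 s.1 x) : Λ ≤ Λ' := by
  classical
  refine ⟨hn, hp, fun i hi A b hA => ?_⟩
  by_cases h : i = x ∧ (b, A) = s
  · obtain ⟨rfl, rfl⟩ := h
    exact hs
  · refine has_of_mem (hm i hi _ ?_)
    by_cases hix : i = x
    · subst hix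
      simp only [rest, Function.update_self]
      exact (Multiset.mem_erase_of_ne fun h' => h ⟨rfl, h'⟩).2 hA
    · simpa [rest, hix] using hA

theorem le_repl {s : Bool × Formula α} {t : Multiset (Bool × Formula α)} (hx : x ≤ Λ.n)
    (hs : (Λ.repl hx s t).Has s.2 s.1 x) : Λ ≤ Λ.repl hx s t :=
  le_of_rest le_rfl (fun _ _ _ => rfl) (fun i _ u hu => by simp [repl, hu]) hs

theorem le_replChild {s : Bool × Formula α} {t : Multiset (Bool × Formula α)} (hx : x ≤ Λ.n)
    (hs : ((Λ.repl hx s 0).child hx t).Has s.2 s.1 x) :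
    Λ ≤ (Λ.repl hx s 0).child hx t :=
  le_of_rest (Nat.le_succ _)
    (fun k _ hk => by simp [child, repl, show k ≠ Λ.n + 1 by omega])
    (fun i _ u hu => by simp [child, repl, hu]) hs

theorem le_add (hx : x ≤ Λ.n) (t : Multiset (Bool × Formula α)) : Λ ≤ Λ.add hx t :=
  ⟨le_rfl, fun _ _ _ => rfl, fun i _ A b h => has_of_mem (by simp [add, h])⟩

theorem le_child (hx : x ≤ Λ.n) (t : Multiset (Bool × Formula α)) : Λ ≤ Λ.child hx t :=
  ⟨Nat.le_succ _, fun k _ hk => by simp [child, show k ≠ Λ.n + 1 by omega],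
    fun i _ A b h => has_of_mem (by simp [child, h])⟩

theorem R_child (hx : x ≤ Λ.n) (t : Multiset (Bool × Formula α)) :
    (Λ.child hx t).R x (Λ.n + 1) := ⟨by omega, le_rfl, by simp [child]⟩

theorem has_repl {s : Bool × Formula α} {t : Multiset (Bool × Formula α)} (hx : x ≤ Λ.n)
    (h : (b, A) ∈ t) : (Λ.repl hx s t).Has A b x := has_of_mem (by simp [repl, h])

theorem has_add {t : Multiset (Bool × Formula α)} (hx : x ≤ Λ.n)
    (h : (b, A) ∈ t) : (Λ.add hx t).Has A b x := has_of_mem (by simp [add, h])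

theorem has_child {t : Multiset (Bool × Formula α)} (hx : x ≤ Λ.n)
    (h : (b, A) ∈ t) : (Λ.child hx t).Has A b (Λ.n + 1) := has_of_mem (by simp [child, h])

end Order

/-! ### Forcing -/

/-- The world and all its extensions are contradictory. -/
def Bot (Λ : World α) : Prop := ∀ Λ', Λ ≤ Λ' → ∀ z ≤ Λ'.n, Λ'.Proves z .bot

/-- Intuitionistic negation of a property of worlds. -/
def Neg (U : World α → Prop) (Λ : World α) : Prop := ∀ Λ', Λ ≤ Λ' → U Λ' → Λ'.Bot

/-- The worlds satisfying `U` cover the world: a sequent is provable at an extension of it as soon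
as it is provable at the further extensions satisfying `U`. -/
def Cov (U : World α → Prop) (Λ : World α) : Prop :=
  ∀ Λ', Λ ≤ Λ' → ∀ z A, z ≤ Λ'.n → (∀ Λ'', Λ' ≤ Λ'' → U Λ'' → Λ''.Proves z A) → Λ'.Proves z A

/-- Forcing. -/
def Forced : Formula α → ℕ → World α → Prop
  | .atomI p, x, Λ => ∀ Λ', Λ ≤ Λ' → Λ'.Proves x (.atomI p)
  -- The inner property is the forcing of `p_i`, unfolded because `p_i` is not a structural subterm
  -- of `p_c`.
  | .atomC p, x, Λ => Neg (Neg fun Λ' => ∀ Λ'', Λ' ≤ Λ'' → Λ''.Proves x (.atomI p)) Λ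
  | .bot, _, Λ => Λ.Bot
  | .neg A, x, Λ => Neg (Forced A x) Λ
  | .and A B, x, Λ => Forced A x Λ ∧ Forced B x Λ
  | .orI A B, x, Λ => Cov (fun Λ' => Forced A x Λ' ∨ Forced B x Λ') Λ
  | .impI A B, x, Λ => ∀ Λ', Λ ≤ Λ' → Forced A x Λ' → Forced B x Λ'
  | .orC A B, x, Λ => Neg (fun Λ' => Neg (Forced A x) Λ' ∧ Neg (Forced B x) Λ') Λ
  | .impC A B, x, Λ => Neg (fun Λ' => Forced A x Λ' ∧ Neg (Forced B x) Λ') Λ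
  | .box A, x, Λ => ∀ Λ', Λ ≤ Λ' → ∀ y, Λ'.R x y → Forced A y Λ'
  | .diaI A, x, Λ => Cov (fun Λ' => ∃ y, Λ'.R x y ∧ Forced A y Λ') Λ
  | .diaC A, x, Λ => Neg (Neg fun Λ' => ∃ y, Λ'.R x y ∧ Forced A y Λ') Λ

section Forcing

variable {Λ Λ' : World α} {U V : World α → Prop} {x y z : ℕ}

theorem bot_mono (h : Λ ≤ Λ') (hb : Λ.Bot) : Λ'.Bot := fun _ h' => hb _ (h.trans h')

theorem neg_mono (h : Λ ≤ Λ') (hb : Neg U Λ) : Neg U Λ' := fun _ h' => hb _ (h.trans h')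

theorem cov_mono (h : Λ ≤ Λ') (hb : Cov U Λ) : Cov U Λ' := fun _ h' => hb _ (h.trans h')

theorem forced_mono {A : Formula α} {Λ Λ' : World α} (h : Λ ≤ Λ') (hA : Forced A x Λ) :
    Forced A x Λ' := by
  induction A generalizing x with
  | atomI p => exact fun _ h' => hA _ (h.trans h')
  | atomC p => exact neg_mono h hA
  | bot => exact bot_mono h hA
  | neg A => exact neg_mono h hA
  | and A B ihA ihB => exact ⟨ihA hA.1, ihB hA.2⟩
  | orI A B => exact cov_mono h hA
  | impI A B => exact fun _ h' => hA _ (h.trans h')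
  | orC A B => exact neg_mono h hA
  | impC A B => exact neg_mono h hA
  | box A => exact fun _ h' => hA _ (h.trans h')
  | diaI A => exact cov_mono h hA
  | diaC A => exact neg_mono h hA

theorem Bot.proves (h : Λ.Bot) (hz : z ≤ Λ.n) : Λ.Proves z .bot := h Λ le_rfl z hz

theorem bot_glue (hc : Cov U Λ) (h : ∀ Λ', Λ ≤ Λ' → U Λ' → Bot Λ') : Bot Λ :=
  fun Λ' hl z hz => hc Λ' hl z _ hz fun Λ'' hl' hU =>
    h Λ'' (hl.trans hl') hU Λ'' le_rfl z (hz.trans (n_mono hl'))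

/-- Persistence of `V` carries its witness to the members of the cover, where it gives a
contradiction; `bot_glue` brings this back. -/
theorem neg_glue (hV : ∀ {Λ Λ'}, Λ ≤ Λ' → V Λ → V Λ') (hc : Cov U Λ)
    (h : ∀ Λ', Λ ≤ Λ' → U Λ' → Neg V Λ') : Neg V Λ :=
  fun _ hl hv => bot_glue (cov_mono hl hc) fun Λ'' hl' hU =>
    h Λ'' (hl.trans hl') hU Λ'' le_rfl (hV hl' hv)

theorem cov_glue (hc : Cov U Λ) (h : ∀ Λ', Λ ≤ Λ' → U Λ' → Cov V Λ') : Cov V Λ :=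
  fun Λ' hl z A hz hk => hc Λ' hl z A hz fun Λ'' hl' hU =>
    h Λ'' (hl.trans hl') hU Λ'' le_rfl z A (hz.trans (n_mono hl')) fun _ h' => hk _ (hl'.trans h')

/-- The sheaf condition. At atoms and `⊥` it is the definition of `Cov`, which concerns provability;
covers compose, negations reduce to `⊥`, and the other clauses inherit it from their subformulas. It
lets the left rules of `∧`, `∨ᵢ`, `→ᵢ`, `□` and `◇ᵢ` act on an arbitrary forced conclusion. The
bound on `x` is needed because covers speak only of nodes of the tree. -/
theorem forced_glue {A : Formula α} {Λ : World α} (hx : x ≤ Λ.n) (hc : Cov U Λ)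
    (h : ∀ Λ', Λ ≤ Λ' → U Λ' → Forced A x Λ') : Forced A x Λ := by
  induction A generalizing x Λ with
  | atomI p =>
    exact fun Λ' hl => hc Λ' hl x _ (hx.trans (n_mono hl)) fun Λ'' hl' hU =>
      h Λ'' (hl.trans hl') hU Λ'' le_rfl
  | atomC p => exact neg_glue neg_mono hc h
  | bot => exact bot_glue hc h
  | neg A => exact neg_glue forced_mono hc h
  | and A B ihA ihB =>
    exact ⟨ihA hx hc fun Λ' hl hU => (h Λ' hl hU).1, ihB hx hc fun Λ' hl hU => (h Λ' hl hU).2⟩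
  | orI A B => exact cov_glue hc h
  | impI A B ihA ihB =>
    exact fun Λ' hl hA => ihB (hx.trans (n_mono hl)) (cov_mono hl hc) fun Λ'' hl' hU =>
      h Λ'' (hl.trans hl') hU Λ'' le_rfl (forced_mono hl' hA)
  | orC A B => exact neg_glue (fun hl h => ⟨neg_mono hl h.1, neg_mono hl h.2⟩) hc h
  | impC A B => exact neg_glue (fun hl h => ⟨forced_mono hl h.1, neg_mono hl h.2⟩) hc h
  | box A ih =>
    exact fun Λ' hl y hR => ih hR.2.1 (cov_mono hl hc) fun Λ'' hl' hU =>
      h Λ'' (hl.trans hl') hU Λ'' le_rfl y (R_mono hl' hR)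
  | diaI A => exact cov_glue hc h
  | diaC A => exact neg_glue neg_mono hc h

/-- By the rule `W`, a contradictory world proves every output, so even the empty property covers
it. -/
theorem cov_of_bot (h : Λ.Bot) : Cov U Λ :=
  fun Λ' hl z _ hz _ => proves_weak hz (h Λ' hl z hz)

theorem cov_of (hU : ∀ Λ', Λ ≤ Λ' → U Λ') : Cov U Λ :=
  fun Λ' hl _ _ _ h => h Λ' le_rfl (hU Λ' hl)

/-- Ex falso is gluing along the empty cover. -/
theorem forced_of_bot {A : Formula α} (hx : x ≤ Λ.n) (h : Λ.Bot) : Forced A x Λ :=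
  forced_glue (U := fun _ => False) hx (cov_of_bot h) fun _ _ h => h.elim

theorem neg_neg_intro (hU : ∀ Λ', Λ ≤ Λ' → U Λ') : Neg (Neg U) Λ :=
  fun Λ' hl hn => hn Λ' le_rfl (hU Λ' hl)

/-- Negative formulas are stable under double negation. -/
theorem forced_of_neg_neg {N : Formula α} (hN : N.Negative) (h : Neg (Neg (Forced N x)) Λ) :
    Forced N x Λ := by
  -- A triple negation of a persistent property collapses to a single one, and each negative formula
  -- is forced by some `Neg V` with `V` persistent.
  have key : ∀ {V : World α → Prop}, (∀ {Λ Λ'}, Λ ≤ Λ' → V Λ → V Λ') →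
      Neg (Neg (Neg V)) Λ → Neg V Λ := by
    intro V hV h Λ' hl hv
    exact h Λ' hl fun Λ'' hl' hn => hn Λ'' le_rfl (hV hl' hv)
  cases N <;> try exact hN.elim
  · exact key neg_mono h
  · exact key forced_mono h
  · exact key (fun hl h => ⟨neg_mono hl h.1, neg_mono hl h.2⟩) h
  · exact key (fun hl h => ⟨forced_mono hl h.1, neg_mono hl h.2⟩) h
  · exact key neg_mono h

end Forcing

/-! ### Forcing and provability -/

/-- The connection of forcing with provability. -/
structure Adequate (A : Formula α) : Prop where
  reify : ∀ (Λ : World α) x, x ≤ Λ.n → Forced A x Λ → Λ.Proves x A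
  left : ∀ (Λ : World α) x, x ≤ Λ.n → Λ.Has A true x → Forced A x Λ
  right : ∀ (Λ : World α) x, x ≤ Λ.n → Λ.Has A false x → Neg (Forced A x) Λ

theorem neg_of {U : World α → Prop} {Λ : World α} (hU : ∀ {Λ Λ'}, Λ ≤ Λ' → U Λ → U Λ')
    (h : ∀ Λ', Λ ≤ Λ' → U Λ' → ∀ z ≤ Λ'.n, Λ'.Proves z .bot) : Neg U Λ :=
  fun _ hl hu Λ'' hl' z hz => h Λ'' (hl.trans hl') (hU hl' hu) z hz

theorem bot_of_has_bot {Λ : World α} {x : ℕ} (hx : x ≤ Λ.n) (h : Λ.Has .bot true x) : Λ.Bot :=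
  fun _ hl _ hz => proves_botL (hx.trans (n_mono hl)) hz (has_mono hl hx h)

/-- If `P` is forced in an extension, its output is provable there by `reify`, and `D` turns the
persisting right input into a contradiction. -/
theorem adequate_of_positive {P : Formula α} (hP : P.Positive)
    (reify : ∀ (Λ : World α) x, x ≤ Λ.n → Forced P x Λ → Λ.Proves x P)
    (left : ∀ (Λ : World α) x, x ≤ Λ.n → Λ.Has P true x → Forced P x Λ) : Adequate P where
  reify := reify
  left := left
  right _ x hx h := neg_of forced_mono fun Λ' hl hP' _ hz =>
    have hx' := hx.trans (n_mono hl)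
    proves_der hx' hz hP (mem_of_has hP (has_mono hl hx h)) (reify Λ' x hx' hP')

/-- `store` adds `N` as a right input; this refutes `N`, while persistence keeps it forced, so the
enlarged world proves `⊥`. -/
theorem adequate_of_negative {N : Formula α} (hN : N.Negative)
    (left : ∀ (Λ : World α) x, x ≤ Λ.n → Λ.Has N true x → Forced N x Λ)
    (right : ∀ (Λ : World α) x, x ≤ Λ.n → Λ.Has N false x → Neg (Forced N x) Λ) : Adequate N where
  reify Λ x hx h :=
    proves_store hx hN (right (Λ.add hx {(false, N)}) x hx (has_add hx (by simp)) _ le_rfl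
      (forced_mono (le_add hx _) h) _ le_rfl x hx)
  left := left
  right := right

theorem adequate_atomI (p : α) : Adequate (.atomI p) :=
  adequate_of_positive (by simp [Formula.Positive, Formula.Negative])
    (fun Λ _ _ h => h Λ le_rfl)
    (fun _ _ hx h Λ' hl => proves_init (hx.trans (n_mono hl)) (has_mono hl hx h))

theorem adequate_bot : Adequate (.bot : Formula α) :=
  adequate_of_positive (by simp [Formula.Positive, Formula.Negative])
    (fun Λ x hx h => h Λ le_rfl x hx) (fun _ _ hx h => bot_of_has_bot hx h)

theorem adequate_and {A B : Formula α} (hA : Adequate A) (hB : Adequate B) :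
    Adequate (.and A B) := by
  refine adequate_of_positive (by simp [Formula.Positive, Formula.Negative])
    (fun Λ x hx h => proves_andR hx (hA.reify Λ x hx h.1) (hB.reify Λ x hx h.2))
    fun Λ x hx h => ?_
  -- In an extension the conjunction is either still present, and `∧•` leads to a world with both
  -- conjuncts, or it has been decomposed already.
  have hc : Cov (fun Λ' => Λ'.Has A true x ∧ Λ'.Has B true x) Λ := by
    intro Λ' hl z D hz hk
    have hx' := hx.trans (n_mono hl)
    rcases has_mono hl hx h with h | h
    · have h' : (Λ'.repl hx' (true, .and A B) ({(true, A)} + {(true, B)})).Has A true x ∧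
          (Λ'.repl hx' (true, .and A B) ({(true, A)} + {(true, B)})).Has B true x :=
        ⟨has_repl hx' (by simp), has_repl hx' (by simp)⟩
      exact proves_andL hx' hz h (hk _ (le_repl hx' (.inr h')) h')
    · exact hk Λ' le_rfl h
  exact ⟨forced_glue hx hc fun Λ' hl h => hA.left Λ' x (hx.trans (n_mono hl)) h.1,
    forced_glue hx hc fun Λ' hl h => hB.left Λ' x (hx.trans (n_mono hl)) h.2⟩

theorem adequate_orI {A B : Formula α} (hA : Adequate A) (hB : Adequate B) :
    Adequate (.orI A B) := by
  refine adequate_of_positive (by simp [Formula.Positive, Formula.Negative])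
    -- The cover is applied to the goal `A ∨ᵢ B` itself, so that a proof is needed only where one
    -- disjunct is forced.
    (fun Λ x hx h => h Λ le_rfl x _ hx fun Λ' hl h' => ?_)
    fun Λ x hx h Λ' hl z D hz hk => ?_
  · have hx' := hx.trans (n_mono hl)
    rcases h' with h' | h'
    · exact proves_orIR₁ hx' (hA.reify Λ' x hx' h')
    · exact proves_orIR₂ hx' (hB.reify Λ' x hx' h')
  · have hx' := hx.trans (n_mono hl)
    rcases has_mono hl hx h with h | h | h
    · have h1 : (Λ'.repl hx' (true, .orI A B) {(true, A)}).Has A true x := has_repl hx' (by simp)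
      have h2 : (Λ'.repl hx' (true, .orI A B) {(true, B)}).Has B true x := has_repl hx' (by simp)
      exact proves_orIL hx' hz h
        (hk _ (le_repl hx' (.inr (.inl h1))) (.inl (hA.left _ x hx' h1)))
        (hk _ (le_repl hx' (.inr (.inr h2))) (.inr (hB.left _ x hx' h2)))
    · exact hk Λ' le_rfl (.inl (hA.left _ x hx' h))
    · exact hk Λ' le_rfl (.inr (hB.left _ x hx' h))

theorem adequate_impI {A B : Formula α} (hA : Adequate A) (hB : Adequate B) :
    Adequate (.impI A B) := by
  refine adequate_of_positive (by simp [Formula.Positive, Formula.Negative])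
    (fun Λ x hx h => proves_impIR hx (hB.reify (Λ.add hx {(true, A)}) x hx
      (h _ (le_add hx _) (hA.left (Λ.add hx {(true, A)}) x hx (has_add hx (by simp))))))
    fun Λ x hx h Λ' hl hA' => ?_
  -- Since `A` is forced, its output is provable, which gives the first premise of `→ᵢ•`. The worlds
  -- containing `B` on the left therefore form a cover.
  refine forced_glue (U := fun Λ' => Λ'.Has B true x) (hx.trans (n_mono hl))
    (fun Λ'' hl' z D hz hk => ?_) fun Λ'' hl' h =>
      hB.left Λ'' x (hx.trans ((n_mono hl).trans (n_mono hl'))) h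
  have hx' := hx.trans ((n_mono hl).trans (n_mono hl'))
  rcases has_mono (hl.trans hl') hx h with h | h
  · have h1 : (Λ''.repl hx' (true, .impI A B) {(true, B)}).Has B true x := has_repl hx' (by simp)
    exact proves_impIL hx' hz h (hA.reify Λ'' x hx' (forced_mono hl' hA'))
      (hk _ (le_repl hx' (.inr h1)) h1)
  · exact hk Λ'' le_rfl h

theorem adequate_box {A : Formula α} (hA : Adequate A) : Adequate (.box A) := by
  refine adequate_of_positive (by simp [Formula.Positive, Formula.Negative])
    -- A fresh empty child serves as the generic successor.
    (fun Λ x hx h => proves_boxR hx (hA.reify (Λ.child hx 0) _ le_rfl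
      (h _ (le_child hx 0) _ (R_child hx 0))))
    fun Λ x hx h Λ' hl y hR => ?_
  refine forced_glue (U := fun Λ' => Λ'.Has A true y) hR.2.1
    (fun Λ'' hl' z D hz hk => ?_) fun Λ'' hl' h => hA.left Λ'' y (R_mono hl' hR).2.1 h
  have hR' := R_mono hl' hR
  exact proves_boxL hR' hz (has_mono (hl.trans hl') hx h)
    (hk _ (le_add hR'.2.1 _) (has_add hR'.2.1 (by simp)))

theorem adequate_diaI {A : Formula α} (hA : Adequate A) : Adequate (.diaI A) := by
  refine adequate_of_positive (by simp [Formula.Positive, Formula.Negative])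
    (fun Λ x hx h => h Λ le_rfl x _ hx fun Λ' hl ⟨y, hR, h'⟩ =>
      proves_diaIR hR (hA.reify Λ' y hR.2.1 h'))
    fun Λ x hx h Λ' hl z D hz hk => ?_
  have hx' := hx.trans (n_mono hl)
  rcases has_mono hl hx h with h | ⟨y, hR, h⟩
  · have hR := R_child (Λ := Λ'.repl hx' (true, .diaI A) 0) hx' {(true, A)}
    have h1 := has_child (Λ := Λ'.repl hx' (true, .diaI A) 0) (b := true) (A := A)
      (t := {(true, A)}) hx' (by simp)
    exact proves_diaIL hx' hz h
      (hk _ (le_replChild hx' (.inr ⟨_, hR, h1⟩)) ⟨_, hR, hA.left _ _ hR.2.1 h1⟩)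
  · exact hk Λ' le_rfl ⟨y, hR, hA.left _ y hR.2.1 h⟩

theorem adequate_neg {A : Formula α} (hA : Adequate A) : Adequate (.neg A) := by
  refine adequate_of_negative trivial
    (fun Λ x hx h => neg_of forced_mono fun Λ' hl h' z hz => ?_)
    fun Λ x hx h => neg_of neg_mono fun Λ' hl h' z hz => ?_
  · have hx' := hx.trans (n_mono hl)
    exact proves_negL hx' hz (has_mono hl hx h) (hA.reify Λ' x hx' h')
  · have hx' := hx.trans (n_mono hl)
    rcases has_mono hl hx h with h | h
    · have h1 : (Λ'.repl hx' (false, .neg A) {(true, A)}).Has A true x := has_repl hx' (by simp)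
      exact proves_negT hx' hz h
        (Bot.proves (h' _ (le_repl hx' (.inr h1)) (hA.left _ x hx' h1)) hz)
    · exact h' Λ' le_rfl (hA.left _ x hx' h) Λ' le_rfl z hz

theorem adequate_atomC (p : α) : Adequate (.atomC p) := by
  have hA := adequate_atomI p
  refine adequate_of_negative trivial
    (fun Λ x hx h => neg_of neg_mono fun Λ' hl h' z hz => ?_)
    fun Λ x hx h => neg_of (U := Forced (.atomC p) x) neg_mono fun Λ' hl h' z hz => ?_
  · have hx' := hx.trans (n_mono hl)
    rcases has_mono hl hx h with h | h
    · have h1 : (Λ'.repl hx' (true, .atomC p) {(true, .atomI p)}).Has (.atomI p) true x :=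
        has_repl hx' (by simp)
      exact proves_atomCL hx' hz h
        (Bot.proves (h' _ (le_repl hx' (.inr h1)) (hA.left _ x hx' h1)) hz)
    · exact h' Λ' le_rfl (hA.left _ x hx' h) Λ' le_rfl z hz
  · have hx' := hx.trans (n_mono hl)
    rcases has_mono hl hx h with h | h
    · have h1 : (Λ'.repl hx' (false, .atomC p) {(false, .atomI p)}).Has (.atomI p) false x :=
        has_repl hx' (by simp)
      exact proves_atomCT hx' hz h
        (Bot.proves (h' _ (le_repl hx' (.inr h1)) (hA.right _ x hx' h1)) hz)
    · exact h' Λ' le_rfl (hA.right _ x hx' h) Λ' le_rfl z hz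

theorem adequate_orC {A B : Formula α} (hA : Adequate A) (hB : Adequate B) :
    Adequate (.orC A B) := by
  refine adequate_of_negative trivial
    (fun Λ x hx h => neg_of (fun hl h => ⟨neg_mono hl h.1, neg_mono hl h.2⟩)
      fun Λ' hl h' z hz => ?_)
    fun Λ x hx h => neg_of (U := Forced (.orC A B) x) neg_mono fun Λ' hl h' z hz => ?_
  · have hx' := hx.trans (n_mono hl)
    rcases has_mono hl hx h with h | h | h
    · have h1 : (Λ'.repl hx' (true, .orC A B) {(true, A)}).Has A true x := has_repl hx' (by simp)
      have h2 : (Λ'.repl hx' (true, .orC A B) {(true, B)}).Has B true x := has_repl hx' (by simp)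
      exact proves_orCL hx' hz h
        (Bot.proves (h'.1 _ (le_repl hx' (.inr (.inl h1))) (hA.left _ x hx' h1)) hz)
        (Bot.proves (h'.2 _ (le_repl hx' (.inr (.inr h2))) (hB.left _ x hx' h2)) hz)
    · exact h'.1 Λ' le_rfl (hA.left _ x hx' h) Λ' le_rfl z hz
    · exact h'.2 Λ' le_rfl (hB.left _ x hx' h) Λ' le_rfl z hz
  · have hx' := hx.trans (n_mono hl)
    rcases has_mono hl hx h with h | h
    · have h1 : (Λ'.repl hx' (false, .orC A B) ({(false, A)} + {(false, B)})).Has A false x ∧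
          (Λ'.repl hx' (false, .orC A B) ({(false, A)} + {(false, B)})).Has B false x :=
        ⟨has_repl hx' (by simp), has_repl hx' (by simp)⟩
      exact proves_orCT hx' hz h (Bot.proves (h' _ (le_repl hx' (.inr h1))
        ⟨hA.right _ x hx' h1.1, hB.right _ x hx' h1.2⟩) hz)
    · exact h' Λ' le_rfl ⟨hA.right _ x hx' h.1, hB.right _ x hx' h.2⟩ Λ' le_rfl z hz

theorem adequate_impC {A B : Formula α} (hA : Adequate A) (hB : Adequate B) :
    Adequate (.impC A B) := by
  refine adequate_of_negative trivial
    (fun Λ x hx h => neg_of (fun hl h => ⟨forced_mono hl h.1, neg_mono hl h.2⟩)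
      fun Λ' hl h' z hz => ?_)
    fun Λ x hx h => neg_of (U := Forced (.impC A B) x) neg_mono fun Λ' hl h' z hz => ?_
  · have hx' := hx.trans (n_mono hl)
    rcases has_mono hl hx h with h | h
    · have h2 : (Λ'.repl hx' (true, .impC A B) {(true, B)}).Has B true x := has_repl hx' (by simp)
      exact proves_impCL hx' hz h (hA.reify Λ' x hx' h'.1)
        (Bot.proves (h'.2 _ (le_repl hx' (.inr h2)) (hB.left _ x hx' h2)) hz)
    · exact h'.2 Λ' le_rfl (hB.left _ x hx' h) Λ' le_rfl z hz
  · have hx' := hx.trans (n_mono hl)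
    rcases has_mono hl hx h with h | h
    · have h1 : (Λ'.repl hx' (false, .impC A B) ({(true, A)} + {(false, B)})).Has A true x ∧
          (Λ'.repl hx' (false, .impC A B) ({(true, A)} + {(false, B)})).Has B false x :=
        ⟨has_repl hx' (by simp), has_repl hx' (by simp)⟩
      exact proves_impCT hx' hz h (Bot.proves (h' _ (le_repl hx' (.inr h1))
        ⟨hA.left _ x hx' h1.1, hB.right _ x hx' h1.2⟩) hz)
    · exact h' Λ' le_rfl ⟨hA.left _ x hx' h.1, hB.right _ x hx' h.2⟩ Λ' le_rfl z hz

theorem adequate_diaC {A : Formula α} (hA : Adequate A) : Adequate (.diaC A) := by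
  refine adequate_of_negative trivial
    (fun Λ x hx h => neg_of neg_mono fun Λ' hl h' z hz => ?_)
    -- The forcing of `◇c A` is a double negation, so it is enough to refute that some child forces
    -- `A`. At such a child `◇c▽` adds `A` as a right input, which is contradictory.
    fun Λ x hx h Λ' hl h' => h' Λ' le_rfl
      (neg_of (fun hl ⟨y, hR, h⟩ => ⟨y, R_mono hl hR, forced_mono hl h⟩)
        fun Λ'' hl' ⟨y, hR, hy⟩ z hz => ?_)
  · have hx' := hx.trans (n_mono hl)
    rcases has_mono hl hx h with h | ⟨y, hR, h⟩
    · have hR := R_child (Λ := Λ'.repl hx' (true, .diaC A) 0) hx' {(true, A)}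
      have h1 := has_child (Λ := Λ'.repl hx' (true, .diaC A) 0) (b := true) (A := A)
        (t := {(true, A)}) hx' (by simp)
      exact proves_diaCL hx' hz h (Bot.proves (h' _ (le_replChild hx' (.inr ⟨_, hR, h1⟩))
        ⟨_, hR, hA.left _ _ hR.2.1 h1⟩) (hz.trans (Nat.le_succ _)))
    · exact h' Λ' le_rfl ⟨y, hR, hA.left _ y hR.2.1 h⟩ Λ' le_rfl z hz
  · exact proves_diaCT hR hz (has_mono (hl.trans hl') hx h)
      (hA.right (Λ''.add hR.2.1 {(false, A)}) y hR.2.1 (has_add hR.2.1 (by simp)) _ le_rfl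
        (forced_mono (le_add hR.2.1 _) hy) _ le_rfl z hz)

theorem adequate (A : Formula α) : Adequate A := by
  induction A with
  | atomI p => exact adequate_atomI p
  | atomC p => exact adequate_atomC p
  | bot => exact adequate_bot
  | neg A ih => exact adequate_neg ih
  | and A B ihA ihB => exact adequate_and ihA ihB
  | orI A B ihA ihB => exact adequate_orI ihA ihB
  | impI A B ihA ihB => exact adequate_impI ihA ihB
  | orC A B ihA ihB => exact adequate_orC ihA ihB
  | impC A B ihA ihB => exact adequate_impC ihA ihB
  | box A ih => exact adequate_box ih
  | diaI A ih => exact adequate_diaI ih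
  | diaC A ih => exact adequate_diaC ih

end World


/-! ### Validity -/

open World

/-- The tree `S` maps to the world, with root `x`, such that all the inputs are forced, and such
that forcing the output entails that `D` is forced at `y`. -/
def Ref (y : ℕ) (D : Formula α) : NSeq α → ℕ → World α → Prop
  | .empty, _, _ => True
  | .left A, x, Λ => Forced A x Λ
  | .right A, x, Λ => Neg (Forced A x) Λ
  -- Continuation form of the output. Choosing the goal to be the output formula at its own node
  -- makes this clause the identity, while input parts of a sequent do not depend on the goal.
  | .out A, x, Λ => ∀ Λ', Λ ≤ Λ' → Forced A x Λ' → Forced D y Λ'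
  | .comma S T, x, Λ => Ref y D S x Λ ∧ Ref y D T x Λ
  | .brack S, x, Λ => ∃ x', Λ.R x x' ∧ Ref y D S x' Λ

/-- The analogue of `Ref` for a context, whose hole is mapped to `k`. -/
def CRef (y : ℕ) (D : Formula α) : Ctx α → ℕ → ℕ → World α → Prop
  | .hole Δ, x, k, Λ => k = x ∧ Ref y D Δ x Λ
  | .nest Δ C, x, k, Λ => Ref y D Δ x Λ ∧ ∃ x', Λ.R x x' ∧ CRef y D C x' k Λ

/-- Validity of sequents in all worlds. -/
def Valid (S : NSeq α) : Prop :=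
  ∀ (Λ : World α) x y D, x ≤ Λ.n → y ≤ Λ.n → Ref y D S x Λ → Forced D y Λ

/-! ### Satisfaction under filling, erasure and change of output. -/

section Ref

variable {Λ Λ' : World α} {S T : NSeq α} {C : Ctx α} {D D' : Formula α} {x y y' k : ℕ}

theorem ref_mono (hl : Λ ≤ Λ') (h : Ref y D S x Λ) : Ref y D S x Λ' := by
  induction S generalizing x with
  | empty => trivial
  | left A => exact forced_mono hl h
  | right A => exact neg_mono hl h
  | out A => exact fun _ hl' => h _ (hl.trans hl')
  | comma S T ihS ihT => exact ⟨ihS h.1, ihT h.2⟩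
  | brack S ih => exact h.imp fun x' h' => ⟨R_mono hl h'.1, ih h'.2⟩

theorem cref_mono (hl : Λ ≤ Λ') (h : CRef y D C x k Λ) : CRef y D C x k Λ' := by
  induction C generalizing x with
  | hole Δ => exact ⟨h.1, ref_mono hl h.2⟩
  | nest Δ C ih =>
    exact ⟨ref_mono hl h.1, h.2.imp fun x' h' => ⟨R_mono hl h'.1, ih h'.2⟩⟩

theorem ref_equiv (h : NSeq.Equiv S T) : Ref y D S x Λ ↔ Ref y D T x Λ := by
  induction h generalizing x with
  | refl => rfl
  | symm _ ih => exact ih.symm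
  | trans _ _ ih ih' => exact ih.trans ih'
  | comma _ _ ih ih' => exact and_congr ih ih'
  | brack _ ih => exact exists_congr fun _ => and_congr_right fun _ => ih
  | assoc => exact and_assoc
  | comm => exact and_comm
  | unit => exact ⟨fun h => h.2, fun h => ⟨trivial, h⟩⟩

theorem ref_fill : Ref y D (C.fill S) x Λ ↔ ∃ k, CRef y D C x k Λ ∧ Ref y D S k Λ := by
  induction C generalizing x with
  | hole Δ =>
    exact ⟨fun h => ⟨x, ⟨rfl, h.1⟩, h.2⟩, fun ⟨k, ⟨hk, h1⟩, h2⟩ => ⟨h1, hk ▸ h2⟩⟩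
  | nest Δ C ih =>
    constructor
    · rintro ⟨h, x', hR, h'⟩
      obtain ⟨k, h1, h2⟩ := ih.1 h'
      exact ⟨k, ⟨h, x', hR, h1⟩, h2⟩
    · rintro ⟨k, ⟨h, x', hR, h1⟩, h2⟩
      exact ⟨h, x', hR, ih.2 ⟨k, h1, h2⟩⟩

theorem cref_node (hx : x ≤ Λ.n) (h : CRef y D C x k Λ) : k ≤ Λ.n := by
  induction C generalizing x with
  | hole Δ => exact h.1 ▸ hx
  | nest Δ C ih =>
    obtain ⟨-, x', hR, h'⟩ := h
    exact ih hR.2.1 h'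

theorem ref_input (hS : S.outs = 0) (h : Ref y D S x Λ) : Ref y' D' S x Λ := by
  induction S generalizing x with
  | empty => trivial
  | left A => exact h
  | right A => exact h
  | out A => simp [NSeq.outs] at hS
  | comma S T ihS ihT =>
    rw [NSeq.outs, Nat.add_eq_zero_iff] at hS
    exact ⟨ihS hS.1 h.1, ihT hS.2 h.2⟩
  | brack S ih => exact h.imp fun x' h' => ⟨h'.1, ih hS h'.2⟩

theorem cref_input (hC : C.IsInput) (h : CRef y D C x k Λ) : CRef y' D' C x k Λ := by
  induction C generalizing x with
  | hole Δ => exact ⟨h.1, ref_input hC h.2⟩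
  | nest Δ C ih =>
    rw [Ctx.IsInput, Ctx.outs, Nat.add_eq_zero_iff] at hC
    exact ⟨ref_input hC.1 h.1, h.2.imp fun x' h' => ⟨h'.1, ih hC.2 h'.2⟩⟩

theorem ref_erase (h : Ref y D S x Λ) : Ref y' D' S.erase x Λ := by
  induction S generalizing x with
  | empty => trivial
  | left A => exact h
  | right A => exact h
  | out A => trivial
  | comma S T ihS ihT => exact ⟨ihS h.1, ihT h.2⟩
  | brack S ih => exact h.imp fun x' h' => ⟨h'.1, ih h'.2⟩

theorem cref_erase (h : CRef y D C x k Λ) : CRef y' D' C.erase x k Λ := by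
  induction C generalizing x with
  | hole Δ => exact ⟨h.1, ref_erase h.2⟩
  | nest Δ C ih => exact ⟨ref_erase h.1, h.2.imp fun x' h' => ⟨h'.1, ih h'.2⟩⟩

/-- An output `⊥` imposes no condition, since a contradictory world forces every goal; only the
inputs matter. This is why the position of the output in `Γ^⊥` is irrelevant. -/
theorem ref_botOut_of_erase (hy : y ≤ Λ.n) (h : Ref y' D' S.erase x Λ) :
    Ref y D S.botOut x Λ := by
  induction S generalizing x with
  | empty => trivial
  | left A => exact h
  | right A => exact h
  | out A => exact fun _ hl hb => forced_of_bot (hy.trans (n_mono hl)) hb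
  | comma S T ihS ihT => exact ⟨ihS h.1, ihT h.2⟩
  | brack S ih => exact h.imp fun x' h' => ⟨h'.1, ih h'.2⟩

theorem cref_botOut_of_erase (hy : y ≤ Λ.n) (h : CRef y' D' C.erase x k Λ) :
    CRef y D C.botOut x k Λ := by
  induction C generalizing x with
  | hole Δ => exact ⟨h.1, ref_botOut_of_erase hy h.2⟩
  | nest Δ C ih => exact ⟨ref_botOut_of_erase hy h.1, h.2.imp fun x' h' => ⟨h'.1, ih h'.2⟩⟩

theorem ref_botOut (hy : y ≤ Λ.n) (h : Ref y' D' S x Λ) : Ref y D S.botOut x Λ :=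
  ref_botOut_of_erase (y' := y) (D' := D) hy (ref_erase h)

theorem cref_botOut (hy : y ≤ Λ.n) (h : CRef y' D' C x k Λ) : CRef y D C.botOut x k Λ :=
  cref_botOut_of_erase (y' := y) (D' := D) hy (cref_erase h)

theorem erase_botOut (S : NSeq α) : S.botOut.erase = S.erase := by
  induction S <;> simp_all [NSeq.botOut, NSeq.erase]

theorem ctx_erase_botOut (C : Ctx α) : C.botOut.erase = C.erase := by
  induction C <;> simp_all [Ctx.botOut, Ctx.erase, erase_botOut]

/-- In a context of the form `Γ^⊥`, the goal may be changed. -/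
theorem cref_botOut_goal (hy : y ≤ Λ.n) (h : CRef y' D' C.botOut x k Λ) :
    CRef y D C.botOut x k Λ :=
  cref_botOut_of_erase (y' := y) (D' := D) hy (ctx_erase_botOut C ▸ cref_erase h)

theorem cref_erase_of_botOut (h : CRef y' D' C.botOut x k Λ) : CRef y D C.erase x k Λ :=
  ctx_erase_botOut C ▸ cref_erase h

/-- For the goal `⊥`, the clause of an output `P` is the very clause of a right input `P`, namely
`Neg (Forced P x)`. This justifies the second form of the classical cut. -/
theorem ref_addOut {P : Formula α} {S S' : NSeq α} (hS : NSeq.AddOut P S S')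
    (h : Ref y .bot S x Λ) : Ref y .bot S' x Λ := by
  induction hS generalizing x with
  | here => exact ⟨h, h⟩
  | commaL T _ ih => exact ⟨ih h.1, h.2⟩
  | commaR S _ ih => exact ⟨h.1, ih h.2⟩
  | brack _ ih => exact h.imp fun x' h' => ⟨h'.1, ih h'.2⟩

theorem Valid.app (hv : Valid (C.fill S)) (hx : x ≤ Λ.n) (hy : y ≤ Λ.n) (hC : CRef y D C x k Λ)
    (hS : Ref y D S k Λ) : Forced D y Λ := hv Λ x y D hx hy (ref_fill.2 ⟨k, hC, hS⟩)

theorem valid_fill (h : ∀ (Λ : World α) x y D k, x ≤ Λ.n → y ≤ Λ.n → k ≤ Λ.n → CRef y D C x k Λ →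
    Ref y D S k Λ → Forced D y Λ) : Valid (C.fill S) := by
  intro Λ x y D hx hy hS
  obtain ⟨k, hC, hS⟩ := ref_fill.1 hS
  exact h Λ x y D k hx hy (cref_node hx hC) hC hS

theorem valid_of_equiv (h : NSeq.Equiv S T) (hS : Valid S) : Valid T :=
  fun Λ x y D hx hy hT => hS Λ x y D hx hy ((ref_equiv h).2 hT)

end Ref

/-! ### Soundness -/

/-- Rules acting on an output use the premises with the active formula as goal, at the node where it
sits. Rules in a context `Γ^⊥` change the goal to `⊥`. The left rules of `∨ᵢ` and `◇ᵢ` glue along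
the cover given by their principal formula. The cuts merely compose their premises. -/
theorem sound_inst {r : Rule} {ps : List (NSeq α)} {S : NSeq α} (h : Inst r ps S)
    (hp : ∀ T ∈ ps, Valid T) : Valid S := by
  cases h with
  | andL C A B hf =>
    simp only [List.mem_singleton, forall_eq] at hp
    exact valid_fill fun Λ x y D k hx hy hk hC hS => hp.app hx hy hC hS
  | andR C A B hf =>
    simp only [List.mem_cons, List.not_mem_nil, or_false, forall_eq_or_imp, forall_eq] at hp
    exact valid_fill fun Λ x y D k hx hy hk hC hS => hS Λ le_rfl
      ⟨hp.1.app hx hk (cref_input hf hC) fun _ _ h => h,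
        hp.2.app hx hk (cref_input hf hC) fun _ _ h => h⟩
  | orIL C A B hf =>
    simp only [List.mem_cons, List.not_mem_nil, or_false, forall_eq_or_imp, forall_eq] at hp
    refine valid_fill fun Λ x y D k hx hy hk hC hS => forced_glue hy hS fun Λ' hl h => ?_
    have hn := n_mono hl
    rcases h with h | h
    · exact hp.1.app (hx.trans hn) (hy.trans hn) (cref_mono hl hC) h
    · exact hp.2.app (hx.trans hn) (hy.trans hn) (cref_mono hl hC) h
  | orIR₁ C A B hf =>
    simp only [List.mem_singleton, forall_eq] at hp
    refine valid_fill fun Λ x y D k hx hy hk hC hS => hS Λ le_rfl (cov_of fun Λ' hl => .inl ?_)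
    exact forced_mono hl (hp.app hx hk (cref_input hf hC) fun _ _ h => h)
  | orIR₂ C A B hf =>
    simp only [List.mem_singleton, forall_eq] at hp
    refine valid_fill fun Λ x y D k hx hy hk hC hS => hS Λ le_rfl (cov_of fun Λ' hl => .inr ?_)
    exact forced_mono hl (hp.app hx hk (cref_input hf hC) fun _ _ h => h)
  | botL C hf => exact valid_fill fun Λ x y D k hx hy hk hC hS => forced_of_bot hy hS
  | impIL C A B hf =>
    simp only [List.mem_cons, List.not_mem_nil, or_false, forall_eq_or_imp, forall_eq] at hp
    exact valid_fill fun Λ x y D k hx hy hk hC hS => hp.2.app hx hy hC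
      (hS Λ le_rfl (hp.1.app hx hk (cref_erase hC) ⟨hS, fun _ _ h => h⟩))
  | impIR C A B hf =>
    simp only [List.mem_singleton, forall_eq] at hp
    exact valid_fill fun Λ x y D k hx hy hk hC hS => hS Λ le_rfl fun Λ' hl hA =>
      hp.app (hx.trans (n_mono hl)) (hk.trans (n_mono hl)) (cref_input hf (cref_mono hl hC))
        ⟨hA, fun _ _ h => h⟩
  | negL C A hf =>
    simp only [List.mem_singleton, forall_eq] at hp
    exact valid_fill fun Λ x y D k hx hy hk hC hS => forced_of_bot hy (hS Λ le_rfl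
      (hp.app hx hk (cref_erase_of_botOut hC) ⟨hS, fun _ _ h => h⟩))
  | negT C A hf =>
    simp only [List.mem_singleton, forall_eq] at hp
    exact valid_fill fun Λ x y D k hx hy hk hC hS => forced_of_bot hy (hS Λ le_rfl
      fun Λ' hl hA => hp.app (D := .bot) (hx.trans (n_mono hl)) (hk.trans (n_mono hl))
        (cref_botOut_goal (hk.trans (n_mono hl)) (cref_mono hl hC)) hA)
  | impCL C A B hf =>
    simp only [List.mem_cons, List.not_mem_nil, or_false, forall_eq_or_imp, forall_eq] at hp
    exact valid_fill fun Λ x y D k hx hy hk hC hS => forced_of_bot hy (hS Λ le_rfl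
      ⟨hp.1.app hx hk (cref_erase_of_botOut hC) ⟨hS, fun _ _ h => h⟩,
        fun Λ' hl hB => hp.2.app (D := .bot) (hx.trans (n_mono hl)) (hk.trans (n_mono hl))
          (cref_botOut_goal (hk.trans (n_mono hl)) (cref_mono hl hC)) hB⟩)
  | impCT C A B hf =>
    simp only [List.mem_singleton, forall_eq] at hp
    exact valid_fill fun Λ x y D k hx hy hk hC hS => forced_of_bot hy (hS Λ le_rfl
      fun Λ' hl hAB => hp.app (D := .bot) (hx.trans (n_mono hl)) (hk.trans (n_mono hl))
        (cref_botOut_goal (hk.trans (n_mono hl)) (cref_mono hl hC)) hAB)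
  | orCL C A B hf =>
    simp only [List.mem_cons, List.not_mem_nil, or_false, forall_eq_or_imp, forall_eq] at hp
    exact valid_fill fun Λ x y D k hx hy hk hC hS => forced_of_bot hy (hS Λ le_rfl
      ⟨fun Λ' hl hA => hp.1.app (D := .bot) (hx.trans (n_mono hl)) (hk.trans (n_mono hl))
          (cref_botOut_goal (hk.trans (n_mono hl)) (cref_mono hl hC)) hA,
        fun Λ' hl hB => hp.2.app (D := .bot) (hx.trans (n_mono hl)) (hk.trans (n_mono hl))
          (cref_botOut_goal (hk.trans (n_mono hl)) (cref_mono hl hC)) hB⟩)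
  | orCT C A B hf =>
    simp only [List.mem_singleton, forall_eq] at hp
    exact valid_fill fun Λ x y D k hx hy hk hC hS => forced_of_bot hy (hS Λ le_rfl
      fun Λ' hl hAB => hp.app (D := .bot) (hx.trans (n_mono hl)) (hk.trans (n_mono hl))
        (cref_botOut_goal (hk.trans (n_mono hl)) (cref_mono hl hC)) hAB)
  | atomCL C p hf =>
    simp only [List.mem_singleton, forall_eq] at hp
    exact valid_fill fun Λ x y D k hx hy hk hC hS => forced_of_bot hy (hS Λ le_rfl
      fun Λ' hl hA => hp.app (D := .bot) (hx.trans (n_mono hl)) (hk.trans (n_mono hl))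
        (cref_botOut_goal (hk.trans (n_mono hl)) (cref_mono hl hC)) hA)
  | atomCT C p hf =>
    simp only [List.mem_singleton, forall_eq] at hp
    exact valid_fill fun Λ x y D k hx hy hk hC hS => forced_of_bot hy (hS Λ le_rfl
      fun Λ' hl hA => hp.app (D := .bot) (hx.trans (n_mono hl)) (hk.trans (n_mono hl))
        (cref_botOut_goal (hk.trans (n_mono hl)) (cref_mono hl hC)) hA)
  | boxL C A Δ hf =>
    simp only [List.mem_singleton, forall_eq] at hp
    refine valid_fill fun Λ x y D k hx hy hk hC ⟨h, x', hR, hΔ⟩ => ?_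
    exact hp.app hx hy hC ⟨h, x', hR, h Λ le_rfl x' hR, hΔ⟩
  | boxR C A hf =>
    simp only [List.mem_singleton, forall_eq] at hp
    exact valid_fill fun Λ x y D k hx hy hk hC hS => hS Λ le_rfl fun Λ' hl x' hR =>
      hp.app (hx.trans (n_mono hl)) hR.2.1 (cref_input hf (cref_mono hl hC))
        ⟨x', hR, fun _ _ h => h⟩
  | diaIL C A hf =>
    simp only [List.mem_singleton, forall_eq] at hp
    exact valid_fill fun Λ x y D k hx hy hk hC hS => forced_glue hy hS fun Λ' hl h =>
      hp.app (hx.trans (n_mono hl)) (hy.trans (n_mono hl)) (cref_mono hl hC) h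
  | diaIR C A Δ hf hΔ =>
    simp only [List.mem_singleton, forall_eq] at hp
    refine valid_fill fun Λ x y D k hx hy hk hC ⟨h, x', hR, hS⟩ => h Λ le_rfl
      (cov_of fun Λ' hl => ⟨x', R_mono hl hR, forced_mono hl ?_⟩)
    exact hp.app hx hR.2.1 (cref_input hf hC) ⟨x', hR, fun _ _ h => h, ref_input hΔ hS⟩
  | diaCL C A hf =>
    simp only [List.mem_singleton, forall_eq] at hp
    exact valid_fill fun Λ x y D k hx hy hk hC hS => forced_of_bot hy (hS Λ le_rfl
      fun Λ' hl hA => hp.app (D := .bot) (hx.trans (n_mono hl)) (hk.trans (n_mono hl))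
        (cref_botOut_goal (hk.trans (n_mono hl)) (cref_mono hl hC)) hA)
  | diaCT C A Δ hf =>
    simp only [List.mem_singleton, forall_eq] at hp
    refine valid_fill fun Λ x y D k hx hy hk hC ⟨h, x', hR, hS⟩ =>
      hp.app hx hy hC ⟨h, x', hR, fun Λ' hl hA => h Λ' hl (neg_neg_intro fun Λ'' hl' =>
        ⟨x', R_mono (hl.trans hl') hR, forced_mono hl' hA⟩), hS⟩
  | ginit C A hf => exact valid_fill fun Λ x y D k hx hy hk hC hS => hS.2 Λ le_rfl hS.1
  | gcinit C A hf =>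
    exact valid_fill fun Λ x y D k hx hy hk hC hS => forced_of_bot hy (hS.2 Λ le_rfl hS.1)
  | der C P hf hP =>
    simp only [List.mem_singleton, forall_eq] at hp
    exact valid_fill fun Λ x y D k hx hy hk hC hS => forced_of_bot hy (hS Λ le_rfl
      (hp.app hx hk (cref_erase_of_botOut hC) ⟨hS, fun _ _ h => h⟩))
  | store C N hf hN =>
    simp only [List.mem_singleton, forall_eq] at hp
    exact valid_fill fun Λ x y D k hx hy hk hC hS => hS Λ le_rfl
      (forced_of_neg_neg hN fun Λ' hl hn => hp.app (D := .bot) (hx.trans (n_mono hl))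
        (hk.trans (n_mono hl)) (cref_input hf (cref_mono hl hC)) ⟨hn, fun _ _ h => h⟩)
  | weak S hf =>
    simp only [List.mem_singleton, forall_eq] at hp
    exact fun Λ x y D hx hy hS => hp Λ x y D hx hy (ref_botOut hy hS)
  | icut C P hf hP =>
    simp only [List.mem_cons, List.not_mem_nil, or_false, forall_eq_or_imp, forall_eq] at hp
    exact valid_fill fun Λ x y D k hx hy hk hC hS => hp.2.app hx hy hC
      (hp.1.app hx hk (cref_erase hC) fun _ _ h => h)
  | ccut C N hf hN =>
    simp only [List.mem_cons, List.not_mem_nil, or_false, forall_eq_or_imp, forall_eq] at hp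
    -- The first premise shows that refuting `N` is contradictory; stability of negative formulas
    -- turns this into `N`, the left input of the second premise.
    exact valid_fill fun Λ x y D k hx hy hk hC hS => hp.2.app hx hy hC
      (forced_of_neg_neg hN fun Λ' hl hn => hp.1.app (D := .bot) (hx.trans (n_mono hl))
        (hk.trans (n_mono hl)) (cref_botOut (hk.trans (n_mono hl)) (cref_mono hl hC)) hn)
  | ccutP C N P S hf hN hP hS =>
    simp only [List.mem_cons, List.not_mem_nil, or_false, forall_eq_or_imp, forall_eq] at hp
    exact valid_fill fun Λ x y D k hx hy hk hC _ => hp.2.app hx hy hC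
      (forced_of_neg_neg hN fun Λ' hl hn => hp.1 Λ' x k .bot (hx.trans (n_mono hl))
        (hk.trans (n_mono hl)) (ref_addOut hS
          (ref_fill.2 ⟨k, cref_erase (cref_mono hl hC), hn⟩)))

theorem sound {R : Rule → Prop} {S : NSeq α} (h : Derivable R S) : Valid S := by
  induction h with
  | step _ hi he _ ih => exact valid_of_equiv he (sound_inst hi ih)

/-! ### Numbers of outputs -/

theorem outs_fill (C : Ctx α) (S : NSeq α) : (C.fill S).outs = C.outs + S.outs := by
  induction C with
  | hole Δ => rfl
  | nest Δ C ih => simp [Ctx.fill, NSeq.outs, Ctx.outs, ih, add_assoc]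

theorem outs_botOut (S : NSeq α) : S.botOut.outs = S.outs := by
  induction S <;> simp_all [NSeq.botOut, NSeq.outs]

theorem outs_erase (S : NSeq α) : S.erase.outs = 0 := by
  induction S <;> simp_all [NSeq.erase, NSeq.outs]

theorem ctx_outs_botOut (C : Ctx α) : C.botOut.outs = C.outs := by
  induction C <;> simp_all [Ctx.botOut, Ctx.outs, outs_botOut]

theorem ctx_outs_erase (C : Ctx α) : C.erase.outs = 0 := by
  induction C <;> simp_all [Ctx.erase, Ctx.outs, outs_erase]

theorem outs_addOut {P : Formula α} {S S' : NSeq α} (h : NSeq.AddOut P S S') :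
    S'.outs = S.outs + 1 := by
  induction h <;> simp_all [NSeq.outs] <;> omega

theorem full_of_inst {r : Rule} {ps : List (NSeq α)} {S : NSeq α} (h : Inst r ps S) :
    S.IsFull ∧ ∀ T ∈ ps, T.IsFull := by
  cases h
  case ccutP C N P S hC _ _ hS =>
    have := outs_addOut hS
    simp_all [NSeq.IsFull, Ctx.IsFull, outs_fill, NSeq.outs, ctx_outs_erase]
  all_goals
    simp_all [NSeq.IsFull, Ctx.IsFull, Ctx.IsInput, NSeq.IsInput, outs_fill, NSeq.outs,
      ctx_outs_erase, ctx_outs_botOut, outs_botOut]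

theorem full_of_derivable {R : Rule → Prop} {S : NSeq α} (h : Derivable R S) : S.IsFull := by
  obtain ⟨-, hi, he, -⟩ := h
  exact (QSeq.equiv_outs he).symm.trans (full_of_inst hi).1

/-! ### Completeness -/

/-- The unique output is brought into the hole of a context by rearranging commas along the path
that leads to it. -/
theorem exists_fill_out {S : NSeq α} (h : S.outs = 1) :
    ∃ (C : Ctx α) (A : Formula α), C.IsInput ∧ NSeq.Equiv (C.fill (.out A)) S := by
  -- Side material next to a filled context is absorbed into the top level of the context.
  have root : ∀ (C : Ctx α) (T : NSeq α), C.IsInput → T.outs = 0 → ∃ C' : Ctx α, C'.IsInput ∧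
      ∀ X, NSeq.Equiv (C'.fill X) (.comma (C.fill X) T) := by
    intro C T hC hT
    cases C with
    | hole Δ =>
      refine ⟨.hole (.comma T Δ), by simp_all [Ctx.IsInput, Ctx.outs, NSeq.outs], fun X => ?_⟩
      exact .trans (.assoc _ _ _) (.comm _ _)
    | nest Δ C =>
      refine ⟨.nest (.comma T Δ) C, by simp_all [Ctx.IsInput, Ctx.outs, NSeq.outs], fun X => ?_⟩
      exact .trans (.assoc _ _ _) (.comm _ _)
  induction S with
  | empty => simp [NSeq.outs] at h
  | left A => simp [NSeq.outs] at h
  | right A => simp [NSeq.outs] at h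
  | out A => exact ⟨.hole .empty, A, rfl, .unit _⟩
  | comma S T ihS ihT =>
    rw [NSeq.outs, Nat.add_eq_one_iff] at h
    rcases h with ⟨hS, hT⟩ | ⟨hS, hT⟩
    · obtain ⟨C, A, hC, he⟩ := ihT hT
      obtain ⟨C', hC', he'⟩ := root C S hC hS
      exact ⟨C', A, hC', (he' _).trans (.trans (.comm _ _) (.comma (.refl _) he))⟩
    · obtain ⟨C, A, hC, he⟩ := ihS hS
      obtain ⟨C', hC', he'⟩ := root C T hC hT
      exact ⟨C', A, hC', (he' _).trans (.comma he (.refl _))⟩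
  | brack S ih =>
    obtain ⟨C, A, hC, he⟩ := ih h
    exact ⟨.nest .empty C, A, by simpa [Ctx.IsInput, Ctx.outs, NSeq.outs] using hC,
      .trans (.unit _) (.brack he)⟩

theorem collapse_child_single (Λ : World α) {x : ℕ} (hx : x ≤ Λ.n) {d : ℕ → QSeq α}
    (hd : ∀ i, Λ.n < i → d i = 0) (q : QSeq α) :
    collapse (Λ.child hx 0).par (Λ.child hx 0).n
        (cont (Λ.child hx 0).m + d + Pi.single (Λ.n + 1) q) =
      collapse Λ.par Λ.n (cont Λ.m + d + Pi.single x (QSeq.brack q)) := by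
  rw [add_assoc, collapse_child]
  refine collapse_congr (fun _ _ _ => rfl) fun k hk => ?_
  simp [hd (Λ.n + 1) (by omega), show k ≠ Λ.n + 1 by omega]

/-- A world can be extended by a copy of an input sequent. -/
theorem exists_extension {S : NSeq α} (hS : S.outs = 0) (Λ : World α) {x : ℕ} (hx : x ≤ Λ.n) :
    ∃ Λ', Λ ≤ Λ' ∧ (∀ y D, Ref y D S x Λ') ∧ ∀ d : ℕ → QSeq α, (∀ i, Λ.n < i → d i = 0) →
      collapse Λ'.par Λ'.n (cont Λ'.m + d) =
        collapse Λ.par Λ.n (cont Λ.m + d + Pi.single x (QSeq.mk S)) := by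
  induction S generalizing Λ x with
  | empty => exact ⟨Λ, le_rfl, fun _ _ => trivial, fun d _ => by simp [QSeq.mk_empty]⟩
  | left A =>
    refine ⟨Λ.add hx {(true, A)}, le_add hx _, fun _ _ => (adequate A).left _ x hx
      (has_add hx (by simp)), fun d _ => ?_⟩
    simp [add, cont_add_single, QSeq.left, add_right_comm]
  | right A =>
    refine ⟨Λ.add hx {(false, A)}, le_add hx _, fun _ _ => (adequate A).right _ x hx
      (has_add hx (by simp)), fun d _ => ?_⟩
    simp [add, cont_add_single, QSeq.right, add_right_comm]
  | out A => simp [NSeq.outs] at hS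
  | comma S T ihS ihT =>
    rw [NSeq.outs, Nat.add_eq_zero_iff] at hS
    obtain ⟨Λ₁, hl₁, h₁, e₁⟩ := ihS hS.1 Λ hx
    obtain ⟨Λ₂, hl₂, h₂, e₂⟩ := ihT hS.2 Λ₁ (hx.trans (n_mono hl₁))
    refine ⟨Λ₂, hl₁.trans hl₂, fun y D => ⟨ref_mono hl₂ (h₁ y D), h₂ y D⟩, fun d hd => ?_⟩
    -- The copy of `T` becomes extra content for the first extension; this is why the equation is
    -- stated for every `d` supported on the old nodes.
    rw [e₂ d fun i hi => hd i ((n_mono hl₁).trans_lt hi), add_assoc, e₁ _ fun i hi => ?_,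
      QSeq.mk_comma, Pi.single_add]
    · congr 1; abel
    · simp [hd i hi, show i ≠ x by omega]
  | brack S ih =>
    obtain ⟨Λ₁, hl₁, h₁, e₁⟩ := ih hS (Λ.child hx 0) (x := Λ.n + 1) le_rfl
    refine ⟨Λ₁, (le_child hx 0).trans hl₁,
      fun y D => ⟨Λ.n + 1, R_mono hl₁ (R_child hx 0), h₁ y D⟩, fun d hd => ?_⟩
    rw [e₁ d fun i hi => hd i ((Nat.lt_succ_self _).trans hi), collapse_child_single Λ hx hd]
    rfl

/-- A world can be extended by a copy of an input context. -/
theorem exists_extension_ctx {C : Ctx α} (hC : C.IsInput) (Λ : World α) {x : ℕ} (hx : x ≤ Λ.n) :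
    ∃ Λ', Λ ≤ Λ' ∧ ∃ z ≤ Λ'.n, (∀ y D, CRef y D C x z Λ') ∧
      ∀ (q : QSeq α) (d : ℕ → QSeq α), (∀ i, Λ.n < i → d i = 0) →
        collapse Λ'.par Λ'.n (cont Λ'.m + d + Pi.single z q) =
          collapse Λ.par Λ.n (cont Λ.m + d + Pi.single x (C.qfill q)) := by
  induction C generalizing Λ x with
  | hole Δ =>
    obtain ⟨Λ₁, hl₁, h₁, e₁⟩ := exists_extension hC Λ hx
    refine ⟨Λ₁, hl₁, x, hx.trans (n_mono hl₁), fun y D => ⟨rfl, h₁ y D⟩, fun q d hd => ?_⟩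
    rw [add_assoc, e₁ _ fun i hi => ?_, Ctx.qfill, Pi.single_add]
    · congr 1; abel
    · simp [hd i hi, show i ≠ x by omega]
  | nest Δ C ih =>
    rw [Ctx.IsInput, Ctx.outs, Nat.add_eq_zero_iff] at hC
    obtain ⟨Λ₁, hl₁, h₁, e₁⟩ := exists_extension hC.1 Λ hx
    have hx₁ := hx.trans (n_mono hl₁)
    obtain ⟨Λ₂, hl₂, z, hz, h₂, e₂⟩ := ih hC.2 (Λ₁.child hx₁ 0) (x := Λ₁.n + 1) le_rfl
    refine ⟨Λ₂, hl₁.trans ((le_child hx₁ 0).trans hl₂), z, hz,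
      fun y D => ⟨ref_mono ((le_child hx₁ 0).trans hl₂) (h₁ y D), Λ₁.n + 1,
        R_mono hl₂ (R_child hx₁ 0), h₂ y D⟩, fun q d hd => ?_⟩
    have hd₁ : ∀ i, Λ₁.n < i → d i = 0 := fun i hi => hd i ((n_mono hl₁).trans_lt hi)
    rw [e₂ q d fun i hi => hd₁ i ((Nat.lt_succ_self _).trans hi),
      collapse_child_single Λ₁ hx₁ hd₁, add_assoc, e₁ _ fun i hi => ?_, Ctx.qfill, Pi.single_add]
    · congr 1; abel
    · simp [hd i hi, show i ≠ x by omega]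

/-- The world with one node and no formula. -/
def World.root (α : Type*) : World α where
  n := 0
  par := id
  m := 0
  isParent k h1 h2 := by omega
  supp _ _ := rfl

/-- The world is the sequent itself, stripped of its output and copied onto the empty root; it
satisfies its inputs by adequacy. The goal is the output formula at its own node, and `reify`
returns a cut-free proof of exactly this sequent. -/
theorem complete {S : NSeq α} (hS : S.IsFull) (h : Valid S) : Provable S := by
  obtain ⟨C, A, hC, he⟩ := exists_fill_out hS
  obtain ⟨Λ, hl, z, hz, hr, e⟩ := exists_extension_ctx hC (World.root α) (x := 0) le_rfl
  have h1 : Forced A z Λ := (valid_of_equiv he.symm h).app (n_mono hl) hz (hr z A) fun _ _ h => h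
  have h2 := (adequate A).reify Λ z hz h1
  have e' := e (QSeq.out A) 0 fun _ _ => rfl
  rw [add_zero] at e'
  rw [Proves, seq, e'] at h2
  have h3 : QSeq.Prv (C.qfill (QSeq.out A)) := by
    simpa [World.root, cont, collapse] using h2
  rw [QSeq.out, ← Ctx.mk_fill, QSeq.prv_mk] at h3
  exact QSeq.derivable_of_equiv he h3

/-! ### Invertible rules, weakening, contraction and cut -/

/-- Soundness covers the cut rules, whereas completeness returns cut-free proofs. -/
theorem admissible_inst (r : Rule) : Admissible (Inst (α := α) r) := fun _ _ hi hp =>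
  complete (full_of_inst hi).1 (sound_inst hi fun T hT => sound (hp T hT))

theorem provableWithCut_iff (S : NSeq α) : ProvableWithCut S ↔ Provable S := by
  constructor
  · exact fun h => complete (full_of_derivable h) (sound h)
  · intro h
    induction h with
    | step _ hi he _ ih => exact .step trivial hi he ih

/-- Semantically, the decomposed formulas entail the principal one, so a world satisfying a premise
satisfies the conclusion. -/
theorem valid_premises {r : Rule} (hr : r ∈ [Rule.orCL, .orCT, .impCL, .impCT, .negL, .negT,
    .atomCL, .atomCT, .diaCL, .diaCT, .der, .andL, .andR, .orIL, .impIR, .diaIL, .boxL, .boxR,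
    .store]) {ps : List (NSeq α)} {S : NSeq α} (h : Inst r ps S) (hS : Valid S) :
    ∀ T ∈ ps, Valid T := by
  cases h with
  | andL C A B hf =>
    simp only [List.mem_singleton, forall_eq]
    exact valid_fill fun Λ x y D k hx hy hk hC h => hS.app hx hy hC h
  | andR C A B hf =>
    simp only [List.mem_cons, List.not_mem_nil, or_false, forall_eq_or_imp, forall_eq]
    have key := fun (Λ : World α) x y D k hx hk (hC : CRef y D C x k Λ) =>
      hS.app (D := .and A B) hx hk (cref_input hf hC) fun _ _ h => h
    exact ⟨valid_fill fun Λ x y D k hx hy hk hC h => h Λ le_rfl (key Λ x y D k hx hk hC).1,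
      valid_fill fun Λ x y D k hx hy hk hC h => h Λ le_rfl (key Λ x y D k hx hk hC).2⟩
  | orIL C A B hf =>
    simp only [List.mem_cons, List.not_mem_nil, or_false, forall_eq_or_imp, forall_eq]
    exact ⟨valid_fill fun Λ x y D k hx hy hk hC h => hS.app hx hy hC
        (cov_of fun _ hl => .inl (forced_mono hl h)),
      valid_fill fun Λ x y D k hx hy hk hC h => hS.app hx hy hC
        (cov_of fun _ hl => .inr (forced_mono hl h))⟩
  | impIR C A B hf =>
    simp only [List.mem_singleton, forall_eq]
    exact valid_fill fun Λ x y D k hx hy hk hC h => h.2 Λ le_rfl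
      (hS.app (D := .impI A B) hx hk (cref_input hf hC) (fun _ _ h => h) Λ le_rfl h.1)
  | negL C A hf =>
    simp only [List.mem_singleton, forall_eq]
    -- A valid conclusion with output `⊥` says that its inputs force every goal; the output of the
    -- premise plays no role. The same holds for the first premise of `→c•` and for `D`.
    exact valid_fill fun Λ x y D k hx hy hk hC h =>
      hS.app hx hy (cref_botOut_of_erase hy hC) h.1
  | negT C A hf =>
    simp only [List.mem_singleton, forall_eq]
    exact valid_fill fun Λ x y D k hx hy hk hC h =>
      hS.app hx hy hC fun Λ' hl hn => hn Λ' le_rfl (forced_mono hl h)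
  | impCL C A B hf =>
    simp only [List.mem_cons, List.not_mem_nil, or_false, forall_eq_or_imp, forall_eq]
    exact ⟨valid_fill fun Λ x y D k hx hy hk hC h =>
        hS.app hx hy (cref_botOut_of_erase hy hC) h.1,
      valid_fill fun Λ x y D k hx hy hk hC h =>
        hS.app hx hy hC fun Λ' hl hn => hn.2 Λ' le_rfl (forced_mono hl h)⟩
  | impCT C A B hf =>
    simp only [List.mem_singleton, forall_eq]
    exact valid_fill fun Λ x y D k hx hy hk hC h =>
      hS.app hx hy hC fun Λ' hl hn => hn Λ' le_rfl ⟨forced_mono hl h.1, neg_mono hl h.2⟩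
  | orCL C A B hf =>
    simp only [List.mem_cons, List.not_mem_nil, or_false, forall_eq_or_imp, forall_eq]
    exact ⟨valid_fill fun Λ x y D k hx hy hk hC h =>
        hS.app hx hy hC fun Λ' hl hn => hn.1 Λ' le_rfl (forced_mono hl h),
      valid_fill fun Λ x y D k hx hy hk hC h =>
        hS.app hx hy hC fun Λ' hl hn => hn.2 Λ' le_rfl (forced_mono hl h)⟩
  | orCT C A B hf =>
    simp only [List.mem_singleton, forall_eq]
    exact valid_fill fun Λ x y D k hx hy hk hC h =>
      hS.app hx hy hC fun Λ' hl hn => hn Λ' le_rfl ⟨neg_mono hl h.1, neg_mono hl h.2⟩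
  | atomCL C p hf =>
    simp only [List.mem_singleton, forall_eq]
    exact valid_fill fun Λ x y D k hx hy hk hC h =>
      hS.app hx hy hC (neg_neg_intro fun _ hl => forced_mono hl h)
  | atomCT C p hf =>
    simp only [List.mem_singleton, forall_eq]
    exact valid_fill fun Λ x y D k hx hy hk hC h =>
      hS.app hx hy hC fun Λ' hl hn => hn Λ' le_rfl (neg_mono hl h)
  | boxL C A Δ hf =>
    simp only [List.mem_singleton, forall_eq]
    -- The rule keeps its principal formula, so the premise is a weakening of the conclusion.
    exact valid_fill fun Λ x y D k hx hy hk hC ⟨h, x', hR, h'⟩ =>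
      hS.app hx hy hC ⟨h, x', hR, h'.2⟩
  | boxR C A hf =>
    simp only [List.mem_singleton, forall_eq]
    exact valid_fill fun Λ x y D k hx hy hk hC ⟨x', hR, h⟩ => h Λ le_rfl
      (hS.app (D := .box A) hx hk (cref_input hf hC) (fun _ _ h => h) Λ le_rfl x' hR)
  | diaIL C A hf =>
    simp only [List.mem_singleton, forall_eq]
    exact valid_fill fun Λ x y D k hx hy hk hC ⟨x', hR, h⟩ =>
      hS.app hx hy hC (cov_of fun _ hl => ⟨x', R_mono hl hR, forced_mono hl h⟩)
  | diaCL C A hf =>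
    simp only [List.mem_singleton, forall_eq]
    exact valid_fill fun Λ x y D k hx hy hk hC ⟨x', hR, h⟩ =>
      hS.app hx hy hC (neg_neg_intro fun _ hl => ⟨x', R_mono hl hR, forced_mono hl h⟩)
  | diaCT C A Δ hf =>
    simp only [List.mem_singleton, forall_eq]
    exact valid_fill fun Λ x y D k hx hy hk hC ⟨h, x', hR, h'⟩ =>
      hS.app hx hy hC ⟨h, x', hR, h'.2⟩
  | der C P hf hP =>
    simp only [List.mem_singleton, forall_eq]
    exact valid_fill fun Λ x y D k hx hy hk hC h =>
      hS.app hx hy (cref_botOut_of_erase hy hC) h.1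
  | store C N hf hN =>
    simp only [List.mem_singleton, forall_eq]
    exact valid_fill fun Λ x y D k hx hy hk hC h => h.2 Λ le_rfl
      (h.1 Λ le_rfl (hS.app hx hk (cref_input hf hC) fun _ _ h => h))
  | _ => simp at hr

theorem invertible_of_mem {r : Rule} (hr : r ∈ [Rule.orCL, .orCT, .impCL, .impCT, .negL, .negT,
    .atomCL, .atomCT, .diaCL, .diaCT, .der, .andL, .andR, .orIL, .impIR, .diaIL, .boxL, .boxR,
    .store]) : Invertible α r := fun _ _ hi hS T hT =>
  complete ((full_of_inst hi).2 T hT) (valid_premises hr hi (sound hS) T hT)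

/-- The side conditions only count outputs: fullness forces the context to be input when an output
is displayed and full when a left formula is. For `□•` the output may lie on either side. -/
theorem exists_inst_of_displayed {r : Rule} {C : Ctx α} {X : NSeq α} (hX : Displayed r X)
    (hC : (C.fill X).IsFull) : ∃ ps, Inst r ps (C.fill X) := by
  rw [NSeq.IsFull, outs_fill] at hC
  cases hX with
  | andL A B => exact ⟨_, .andL C A B hC⟩
  | andR A B => exact ⟨_, .andR C A B (Nat.succ_injective hC)⟩
  | orIL A B => exact ⟨_, .orIL C A B hC⟩
  | impIR A B => exact ⟨_, .impIR C A B (Nat.succ_injective hC)⟩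
  | diaIL A => exact ⟨_, .diaIL C A hC⟩
  | boxL A Δ => exact ⟨_, .boxL C A Δ (by simpa [NSeq.outs] using hC)⟩
  | boxR A => exact ⟨_, .boxR C A (Nat.succ_injective hC)⟩
  | store N hN => exact ⟨_, .store C N (Nat.succ_injective hC) hN⟩

/-! ### Merges of contexts. -/

section Merge

variable {L G M M' : Ctx α} {Λ : World α} {D : Formula α} {x y k : ℕ}

theorem outs_merge (h : Ctx.IsMerge L G M) : M.outs = L.outs + G.outs := by
  induction h with
  | hole => rfl
  | nest Δ Θ _ ih => simp only [Ctx.outs, NSeq.outs, ih]; omega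

theorem cref_merge_right (h : Ctx.IsMerge L G M) (hM : CRef y D M x k Λ) : CRef y D G x k Λ := by
  induction h generalizing x with
  | hole => exact ⟨hM.1, hM.2.2⟩
  | nest Δ Θ _ ih => exact ⟨hM.1.2, hM.2.imp fun x' h' => ⟨h'.1, ih h'.2⟩⟩

/-- Satisfaction does not count occurrences, and both copies of `L` may be sent along the same path
of nodes. -/
theorem cref_merge_contract (h : Ctx.IsMerge L G M) (h' : Ctx.IsMerge L M M')
    (hM : CRef y D M x k Λ) : CRef y D M' x k Λ := by
  induction h generalizing M' x with
  | hole => cases h'; exact ⟨hM.1, hM.2.1, hM.2⟩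
  | nest Δ Θ _ ih =>
    cases h' with
    | nest _ _ h' => exact ⟨⟨hM.1.1, hM.1⟩, hM.2.imp fun x' hx' => ⟨hx'.1, ih h' hx'.2⟩⟩

end Merge

theorem admissible_weakC : Admissible (WeakC (α := α)) := by
  rintro _ _ ⟨L, G, M, S, hL, hG, hM⟩ hp
  simp only [List.mem_singleton, forall_eq] at hp
  refine complete ?_ (valid_fill fun Λ x y D k hx hy hk hC h =>
    (sound hp).app hx hy (cref_merge_right hM hC) h)
  rw [NSeq.IsFull, outs_fill, outs_merge hM, show L.outs = 0 from hL, zero_add, ← outs_fill]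
  exact hG

theorem admissible_contrC : Admissible (ContrC (α := α)) := by
  rintro _ _ ⟨L, G, M, M', S, hL, hG, hM, hM'⟩ hp
  simp only [List.mem_singleton, forall_eq] at hp
  refine complete ?_ (valid_fill fun Λ x y D k hx hy hk hC h =>
    (sound hp).app hx hy (cref_merge_contract hM hM' hC) h)
  rw [NSeq.IsFull, outs_fill, outs_merge hM, show L.outs = 0 from hL, zero_add, ← outs_fill]
  exact hG

end NestedEK

theorem mainTheorem3 (α : Type*) :
    -- invertible rules
    (∀ r ∈ [NestedEK.Rule.orCL, .orCT, .impCL, .impCT, .negL, .negT, .atomCL, .atomCT,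
        .diaCL, .diaCT, .der], NestedEK.Invertible α r) ∧
    -- totally invertible rules
    (∀ r ∈ [NestedEK.Rule.andL, .andR, .orIL, .impIR, .diaIL, .boxL, .boxR, .store],
        NestedEK.TotallyInvertible α r) ∧
    -- classical weakening and contraction
    NestedEK.Admissible (NestedEK.WeakC (α := α)) ∧
    NestedEK.Admissible (NestedEK.ContrC (α := α)) ∧
    -- the cut rules, hence cut elimination, and the ecumenical weight of the modalities
    NestedEK.Admissible (NestedEK.Inst (α := α) .icut) ∧
    NestedEK.Admissible (NestedEK.Inst (α := α) .ccut) ∧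
    (∀ S : NestedEK.NSeq α, NestedEK.ProvableWithCut S ↔ NestedEK.Provable S) ∧
    (∀ A : NestedEK.Formula α, A.diaI.ew = A.ew + 1 ∧ A.box.ew = A.ew + 1 ∧
        A.diaC.ew = A.ew + 4) :=
  ⟨fun _ hr => NestedEK.invertible_of_mem (List.mem_append_left _ hr),
    fun _ hr => ⟨NestedEK.invertible_of_mem (List.mem_append_right
      [NestedEK.Rule.orCL, .orCT, .impCL, .impCT, .negL, .negT, .atomCL, .atomCT, .diaCL, .diaCT,
        .der] hr), fun _ _ hX hC => NestedEK.exists_inst_of_displayed hX hC⟩,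
    NestedEK.admissible_weakC, NestedEK.admissible_contrC, NestedEK.admissible_inst _,
    NestedEK.admissible_inst _, NestedEK.provableWithCut_iff, fun _ => ⟨rfl, rfl, rfl⟩⟩
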